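/- Let $U\subseteq\mathbb R^n$ be open, let $a_{ij},b_i,V\in C^3(U)$ be real functions, and on the phase space $\Omega=\{(q,p): q\in U,\ p\in\mathbb R^n\}$ put $$J=K+V(q),\qquad K(p,q)=\sum_{i,j=1}^n a_{ij}(q)p_ip_j+\sum_{i=1}^n b_i(q)p_i .$$ Let $A=\{\cdot,K\}=\sum_i(K_{p_i}\partial_{q_i}-K_{q_i}\partial_{p_i})$, $B=\{\cdot,V\}=-\sum_iV_{q_i}\partial_{p_i}$ and $D=[B,[A,B]]$. For a vector field $X$ on $\Omega$ let $e^{X}$ be the time-one map of its (local) flow in $\Omega$, a partially defined map. For a step size $\tau\in\mathbb R$ and $B_c:=B+c\tau^2D$ the extended methods are - $N2=e^{\frac\tau2B_c}e^{\tau A}e^{\frac\tau2B_c}$, $c=\frac1{24}$; - $N4=e^{\frac\tau2(1-\frac1{\sqrt3})A}e^{\frac\tau2B_c}e^{\frac{\tau}{\sqrt3}A}e^{\frac\tau2B_c}e^{\frac\tau2(1-\frac1{\sqrt3})A}$, $c=\frac{2-\sqrt3}{24}$; - $N4^*=e^{\frac\tau6B_c}e^{\frac\tau2A}e^{\frac{2\tau}3B_c}e^{\frac\tau2A}e^{\frac\tau6B_c}$,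 $c=\frac1{72}$; - $N4O=e^{\lambda\tau B_c}e^{\frac\tau2A}e^{(1-2\lambda)\tau B_c}e^{\frac\tau2A}e^{\lambda\tau B_c}$, $c=6\xi+k$, $\lambda=\frac16$, $\xi=-\frac{17}{18000}$, $\chi=\frac{71}{4500}$, $k=-4\xi-\frac12+\frac{3\chi}2$; - $N4V=e^{\lambda\tau B_c}e^{\theta\tau A}e^{(1-2\lambda)\frac\tau2B_c}e^{(1-2\theta)\tau A}e^{(1-2\lambda)\frac\tau2B_c}e^{\theta\tau A}e^{\lambda\tau B_c}$, $c=2(\xi+\chi)$, $\theta=0.2728983001988755$, $\lambda=0.08002565306418866$, $\chi=0.002960781208329478$, $\xi=0.0002725753410753895$; - $N4P=e^{\theta\tau A}e^{\lambda\tau B_c}e^{(1-2\theta)\frac\tau2A}e^{(1-2\lambda)\tau B_c}e^{(1-2\theta)\frac\tau2A}e^{\lambda\tau B_c}e^{\theta\tau A}$, $c=2\xi+\chi$, $\theta=0.1159953608486416$, $\lambda=0.2825633404177051$, $\chi=0.003035236056708454$, $\xi=0.001226088989536361$. Then the following hold. 1. On $\Omega$, $D=\sum_i D_i\,\partial_{p_i}$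 with $D_i=\sum_{j,k}\bigl(2V_{q_iq_j}V_{q_k}K_{p_jp_k}+V_{q_j}V_{q_k}K_{q_ip_jp_k}\bigr)$. The function $V_D:=2\sum_{j,k}a_{jk}V_{q_j}V_{q_k}$ is $C^2$ on $U$ and $\partial V_D/\partial q_i=D_i$ for all $i$. If $(a_{jk})$ is symmetric, then $\partial V_D/\partial q_i=2\sum_{j,k}\bigl(2a_{jk}V_{q_iq_j}V_{q_k}+V_{q_j}V_{q_k}\,\partial a_{jk}/\partial q_i\bigr)$. 2. For all real $c,\tau,t$, the exact time-$t$ flow in $\Omega$ of the Hamiltonian $V-c\tau^2V_D$ is the explicit map $(q,p)\mapsto\bigl(q,\,p-t\,\nabla(V-c\tau^2V_D)(q)\bigr)$. For each of the six methods $N$ and each $\tau$, replacing every factor $e^{s\tau A}$ by the exact time-$s\tau$ flow of $K$ and every factor $e^{t\tau(B+c\tau^2D)}$ by the exact time-$t\tau$ flow of $V-c\tau^2V_D$ does not change the method. 3. Each $N(\tau)$ is a homeomorphism from an open subset of $\Omega$ onto an open subset of phase space; every point of $\Omega$ lies in its domain for all sufficiently small $|\tau|$, and if the flow of $K$ on $\Omega$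 is complete, then its domain and its image are $\Omega$ for every $\tau$. On its domain $N(\tau)$ is $C^1$ and its Jacobian matrix $\mathbf S$ with respect to $(q_1,\dots,q_n,p_1,\dots,p_n)$ satisfies $\mathbf S^T\mathbf I\mathbf S=\mathbf I$ with $\mathbf I=\begin{pmatrix}0&-1_n\\1_n&0\end{pmatrix}$, and $\det\mathbf S=1$. 4. Each method is a palindromic product whose exponents are odd in $\tau$, and it is symmetric (time-reversible): the domain of $N(-\tau)$ is the image of $N(\tau)$, and there $N(\tau)N(-\tau)=\mathrm{id}$. -/

import Mathlib

open scoped Topology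

noncomputable section

namespace ForceGradient

/-- Phase space `ℝ²ⁿ`: the coordinate `z (Sum.inl i)` is `q i` and `z (Sum.inr i)` is `p i`. -/
abbrev Phase (n : ℕ) : Type := Fin n ⊕ Fin n → ℝ

/-- The coordinate part `q` of a phase point. -/
def pos {n : ℕ} (z : Phase n) : Fin n → ℝ := fun i => z (Sum.inl i)

/-- The momentum part `p` of a phase point. -/
def mom {n : ℕ} (z : Phase n) : Fin n → ℝ := fun i => z (Sum.inr i)

/-- The phase points whose coordinates lie in the configuration domain `U`. -/
def phaseDomain {n : ℕ} (U : Set (Fin n → ℝ)) : Set (Phase n) := {z | pos z ∈ U}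

/-- The partial derivative of `f` with respect to the `i`-th variable. -/
def pd {ι : Type} [Fintype ι] [DecidableEq ι] (i : ι) (f : (ι → ℝ) → ℝ) (x : ι → ℝ) : ℝ :=
  fderiv ℝ f x (Pi.single i 1)

/-- The formal kinetic energy `K(p, q) = ∑ a i j (q) p i p j + ∑ b i (q) p i`. -/
def kinetic {n : ℕ} (a : Fin n → Fin n → (Fin n → ℝ) → ℝ) (b : Fin n → (Fin n → ℝ) → ℝ)
    (z : Phase n) : ℝ :=
  (∑ i, ∑ j, a i j (pos z) * mom z i * mom z j) + ∑ i, b i (pos z) * mom z i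

/-- A function of the coordinates, seen as a function on phase space. -/
def lift {n : ℕ} (W : (Fin n → ℝ) → ℝ) (z : Phase n) : ℝ := W (pos z)

/-- The Hamiltonian vector field of `H`, that is, the coefficients of the Lie operator
`{·, H} = ∑ i, (∂H/∂p i) ∂/∂q i - (∂H/∂q i) ∂/∂p i`. -/
def hamField {n : ℕ} (H : Phase n → ℝ) (z : Phase n) : Phase n :=
  Sum.elim (fun i => pd (Sum.inr i) H z) (fun i => -pd (Sum.inl i) H z)

/-- The operator `A = {·, K}`. -/
def opA {n : ℕ} (a : Fin n → Fin n → (Fin n → ℝ) → ℝ) (b : Fin n → (Fin n → ℝ) → ℝ) :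
    Phase n → Phase n :=
  hamField (kinetic a b)

/-- The operator `B = {·, V}`. -/
def opB {n : ℕ} (V : (Fin n → ℝ) → ℝ) : Phase n → Phase n := hamField (lift V)

/-- The operator `D = [B, [A, B]]`. The Lie bracket of vector fields used here is the commutator
of the corresponding first-order differential operators. -/
def opD {n : ℕ} (a : Fin n → Fin n → (Fin n → ℝ) → ℝ) (b : Fin n → (Fin n → ℝ) → ℝ)
    (V : (Fin n → ℝ) → ℝ) : Phase n → Phase n :=
  VectorField.lieBracket ℝ (opB V) (VectorField.lieBracket ℝ (opA a b) (opB V))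

/-- The function `V_D = 2 ∑ a j k (∂V/∂q j) (∂V/∂q k)`. -/
def potD {n : ℕ} (a : Fin n → Fin n → (Fin n → ℝ) → ℝ) (V : (Fin n → ℝ) → ℝ)
    (q : Fin n → ℝ) : ℝ :=
  2 * ∑ j, ∑ k, a j k q * pd j V q * pd k V q

/-- The modified potential `V - c τ² V_D`. -/
def modPot {n : ℕ} (a : Fin n → Fin n → (Fin n → ℝ) → ℝ) (V : (Fin n → ℝ) → ℝ)
    (c τ : ℝ) (q : Fin n → ℝ) : ℝ :=
  V q - c * τ ^ 2 * potD a V q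

/-- The graph of the time-`t` map of the (local) flow of the vector field `X` on `Ω`: `z` is related
to `w` if a solution of `γ' = X(γ)` with `γ 0 = z` exists and stays in `Ω` between the times
`0` and `t` (`t` may be negative), and `γ t = w`. -/
def FlowRel {n : ℕ} (Ω : Set (Phase n)) (X : Phase n → Phase n) (t : ℝ) (z w : Phase n) : Prop :=
  ∃ γ : ℝ → Phase n, γ 0 = z ∧ γ t = w ∧ IsIntegralCurveOn γ (fun _ => X) (Set.uIcc 0 t) ∧
    ∀ s ∈ Set.uIcc 0 t, γ s ∈ Ω

/-- The graph of `e^X`, the time-one map of the vector field `X` on `Ω`. -/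
def ExpRel {n : ℕ} (Ω : Set (Phase n)) (X : Phase n → Phase n) : Phase n → Phase n → Prop :=
  FlowRel Ω X 1

/-- Composition of (the graphs of) partial maps; the first one in the list is applied first. -/
def composeAll {n : ℕ} : List (Phase n → Phase n → Prop) → Phase n → Phase n → Prop
  | [] => Eq
  | r :: rs => Relation.Comp r (composeAll rs)

/-- A factor of a composition scheme with step size `τ`:
`drift s` stands for `e^{sτA}` and `kick t` for `e^{tτ(B + cτ²D)}`. -/
inductive Step where
  | drift (s : ℝ)
  | kick (t : ℝ)

/-- A composition scheme: its factors and the coefficient `c` of `τ²D`. -/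
structure Scheme where
  c : ℝ
  steps : List Step

/-- The exponent of a factor. -/
def Step.exponent {n : ℕ} (a : Fin n → Fin n → (Fin n → ℝ) → ℝ) (b : Fin n → (Fin n → ℝ) → ℝ)
    (V : (Fin n → ℝ) → ℝ) (c τ : ℝ) : Step → Phase n → Phase n
  | .drift s => (s * τ) • opA a b
  | .kick t => (t * τ) • (opB V + (c * τ ^ 2) • opD a b V)

/-- The list of all exponents of a scheme. -/
def Scheme.exponents {n : ℕ} (S : Scheme) (a : Fin n → Fin n → (Fin n → ℝ) → ℝ)
    (b : Fin n → (Fin n → ℝ) → ℝ) (V : (Fin n → ℝ) → ℝ) (τ : ℝ) : List (Phase n → Phase n) :=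
  S.steps.map (Step.exponent a b V S.c τ)

/-- (The graph of) the integrator of a scheme with step size `τ`: the product of the exponentials
of its exponents. -/
def Scheme.integrator {n : ℕ} (S : Scheme) (U : Set (Fin n → ℝ))
    (a : Fin n → Fin n → (Fin n → ℝ) → ℝ) (b : Fin n → (Fin n → ℝ) → ℝ) (V : (Fin n → ℝ) → ℝ)
    (τ : ℝ) : Phase n → Phase n → Prop :=
  composeAll ((S.exponents a b V τ).map (ExpRel (phaseDomain U)))

/-- A factor of the splitting method for the modified Hamiltonian `K + (V - c τ² V_D)`: the exact
flow of the Hamiltonian `K` or of the Hamiltonian `V - c τ² V_D`. -/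
def Step.exactFlow {n : ℕ} (U : Set (Fin n → ℝ)) (a : Fin n → Fin n → (Fin n → ℝ) → ℝ)
    (b : Fin n → (Fin n → ℝ) → ℝ) (V : (Fin n → ℝ) → ℝ) (c τ : ℝ) :
    Step → Phase n → Phase n → Prop
  | .drift s => FlowRel (phaseDomain U) (hamField (kinetic a b)) (s * τ)
  | .kick t => FlowRel (phaseDomain U) (hamField (lift (modPot a V c τ))) (t * τ)

/-- The splitting method for `K + (V - c τ² V_D)`. -/
def Scheme.modifiedSplitting {n : ℕ} (S : Scheme) (U : Set (Fin n → ℝ))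
    (a : Fin n → Fin n → (Fin n → ℝ) → ℝ) (b : Fin n → (Fin n → ℝ) → ℝ) (V : (Fin n → ℝ) → ℝ)
    (τ : ℝ) : Phase n → Phase n → Prop :=
  composeAll (S.steps.map (Step.exactFlow U a b V S.c τ))

/-- The six extended methods. -/
inductive Method where
  | N2
  | N4
  | N4star
  | N4O
  | N4V
  | N4P

/-- The five-stage scheme `kick, drift, kick, drift, kick` of the method N4O. -/
def schemeO (lam xi k : ℝ) : Scheme where
  c := 6 * xi + k
  steps := [.kick lam, .drift (1 / 2), .kick (1 - 2 * lam), .drift (1 / 2), .kick lam]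

/-- The velocity-version seven-stage scheme of the method N4V. -/
def schemeV (theta lam chi xi : ℝ) : Scheme where
  c := 2 * (xi + chi)
  steps := [.kick lam, .drift theta, .kick ((1 - 2 * lam) / 2), .drift (1 - 2 * theta),
    .kick ((1 - 2 * lam) / 2), .drift theta, .kick lam]

/-- The position-version seven-stage scheme of the method N4P. -/
def schemeP (theta lam chi xi : ℝ) : Scheme where
  c := 2 * xi + chi
  steps := [.drift theta, .kick lam, .drift ((1 - 2 * theta) / 2), .kick (1 - 2 * lam),
    .drift ((1 - 2 * theta) / 2), .kick lam, .drift theta]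

/-- The coefficients of the six methods. -/
def Method.scheme : Method → Scheme
  | .N2 => { c := 1 / 24, steps := [.kick (1 / 2), .drift 1, .kick (1 / 2)] }
  | .N4 =>
    { c := (2 - √3) / 24
      steps := [.drift ((1 - 1 / √3) / 2), .kick (1 / 2), .drift (1 / √3), .kick (1 / 2),
        .drift ((1 - 1 / √3) / 2)] }
  | .N4star =>
    { c := 1 / 72
      steps := [.kick (1 / 6), .drift (1 / 2), .kick (2 / 3), .drift (1 / 2), .kick (1 / 6)] }
  | .N4O => schemeO (1 / 6) (-17 / 18000)
      (-4 * (-17 / 18000) - 1 / 2 + 3 * (71 / 4500) / 2)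
  | .N4V => schemeV 0.2728983001988755 0.08002565306418866 0.002960781208329478
      0.0002725753410753895
  | .N4P => schemeP 0.1159953608486416 0.2825633404177051 0.003035236056708454
      0.001226088989536361

/-- The Jacobian matrix of a map of phase space, in the coordinates `(q, p)`. -/
def jacobian {n : ℕ} (f : Phase n → Phase n) (z : Phase n) :
    Matrix (Fin n ⊕ Fin n) (Fin n ⊕ Fin n) ℝ :=
  LinearMap.toMatrix' (fderiv ℝ f z : Phase n →ₗ[ℝ] Phase n)

end ForceGradient

end

/-!
The theorem has an algebraic and an analytic half.

For the algebra, `A = {·, K}` is quadratic in the momenta and `B = {·, V}` is vertical (its `q`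
components vanish) and independent of the momenta. Each bracket with `B` differentiates in a
vertical direction and lowers the degree in the momenta by one, so that `D = [B, [A, B]]` is again
vertical and independent of the momenta (`opD_apply`); its momentum components are recognised as the
gradient of `V_D` by the symmetry of second derivatives (`pd_potD_eq_opD`). Hence `B + cτ²D` is the
Hamiltonian field of `V - cτ²V_D` (`opB_add_smul_opD_eqOn`). Since this field is constant along its
integral curves, its flow is `z ↦ z + t X(z)` (`flowRel_hamField_lift_iff`).

For the analysis, a property of relations on phase space is used which passes to products: the
relation `r` is locally symplectic at a pair `(z, w)` if near it `r` contains the graph of a `C¹`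
map whose derivative at `z` preserves the symplectic form (`IsLocallySymplecticAt`). Kicks have it
by direct computation, because the derivative of a Hamiltonian field is skew for the symplectic
form. For drifts it follows from the differentiability of the flow in the initial value. As `A` is
`C²`, the flow and its derivative together solve an equation with a `C¹` right-hand side, the
variational equation, so that Picard–Lindelöf provides a continuous candidate for the derivative,
and Grönwall's inequality shows that it is the derivative (`exists_local_flow`). Along the
variational equation the symplectic form is constant. Short times suffice: by compactness an
integral curve is covered by finitely many short flows (`FlowRel.isLocallySymplecticAt`).

The integrator is then a functional relation which is locally symplectic, and its inverse relation
is the integrator with step size `-τ`, because the scheme is palindromic and every factor is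
inverted by reversing time. Such a relation is the graph of a symplectic homeomorphism between open
sets (`exists_openPartialHomeomorph`), and symplectic matrices have determinant one.
-/

noncomputable section

namespace ForceGradient

/-! ### Differentiable dependence of solutions on the initial value -/

section LocalFlow

variable {E : Type*} [NormedAddCommGroup E] [NormedSpace ℝ E]

/-- If `N` solves the variational equation along the integral curve `γ`, then `N t` applied to
the difference of the initial values is a first-order approximation of `δ t - γ t` for every
integral curve `δ` that stays close to `γ`: the error is quadratic, by Grönwall's inequality. -/
theorem norm_sub_variational_le {X : E → E} {S : Set E} (hS : Convex ℝ S)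
    (hX : ∀ y ∈ S, DifferentiableAt ℝ X y) {K C L ε : ℝ} (hK : 0 < K) (hL : 0 ≤ L)
    (hbound : ∀ y ∈ S, ‖fderiv ℝ X y‖ ≤ K) (hC : 0 ≤ C)
    (hlip : ∀ y ∈ S, ∀ y' ∈ S, ‖fderiv ℝ X y - fderiv ℝ X y'‖ ≤ C * ‖y - y'‖)
    {γ δ : ℝ → E} {N : ℝ → E →L[ℝ] E} (hγS : ∀ t ∈ Set.Icc 0 ε, γ t ∈ S)
    (hδS : ∀ t ∈ Set.Icc 0 ε, δ t ∈ S)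
    (hγ : ∀ t ∈ Set.Icc 0 ε, HasDerivWithinAt γ (X (γ t)) (Set.Icc 0 ε) t)
    (hδ : ∀ t ∈ Set.Icc 0 ε, HasDerivWithinAt δ (X (δ t)) (Set.Icc 0 ε) t)
    (hN : ∀ t ∈ Set.Icc 0 ε, HasDerivWithinAt N ((fderiv ℝ X (γ t)).comp (N t)) (Set.Icc 0 ε) t)
    (hN0 : N 0 = ContinuousLinearMap.id ℝ E)
    (hclose : ∀ t ∈ Set.Icc 0 ε, ‖δ t - γ t‖ ≤ L * ‖δ 0 - γ 0‖) :
    ∀ t ∈ Set.Icc 0 ε, ‖δ t - γ t - N t (δ 0 - γ 0)‖ ≤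
      (C * L ^ 2 / K * (Real.exp (K * t) - 1)) * ‖δ 0 - γ 0‖ ^ 2 := by
  intro t ht
  set h := δ 0 - γ 0 with hh
  have hd : ∀ s ∈ Set.Icc 0 ε, HasDerivWithinAt (fun s => δ s - γ s - N s h)
      (X (δ s) - X (γ s) - fderiv ℝ X (γ s) (N s h)) (Set.Icc 0 ε) s := by
    intro s hs
    have h1 := (hN s hs).clm_apply (hasDerivWithinAt_const s (Set.Icc 0 ε) h)
    simp only [ContinuousLinearMap.coe_comp, Function.comp_apply, map_zero, add_zero] at h1
    exact ((hδ s hs).sub (hγ s hs)).sub h1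
  have key := norm_le_gronwallBound_of_norm_deriv_right_le (a := 0) (b := ε) (δ := 0) (K := K)
    (ε := C * L ^ 2 * ‖h‖ ^ 2) (f := fun s => δ s - γ s - N s h)
    (f' := fun s => X (δ s) - X (γ s) - fderiv ℝ X (γ s) (N s h))
    (fun s hs => (hd s hs).continuousWithinAt)
    (fun s hs => ((hd s ⟨hs.1, hs.2.le⟩).mono_of_mem_nhdsWithin
      (Icc_mem_nhdsGE_of_mem hs)))
    (by simp [hN0, hh]) ?_ t ht
  · refine key.trans (le_of_eq ?_)
    rw [gronwallBound_of_K_ne_0 hK.ne']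
    ring_nf
  · intro s hs
    have hs' : s ∈ Set.Icc 0 ε := ⟨hs.1, hs.2.le⟩
    have hsub : segment ℝ (γ s) (δ s) ⊆ S := hS.segment_subset (hγS s hs') (hδS s hs')
    have h2 : ‖X (δ s) - X (γ s) - fderiv ℝ X (γ s) (δ s - γ s)‖ ≤
        (C * ‖δ s - γ s‖) * ‖δ s - γ s‖ := by
      refine Convex.norm_image_sub_le_of_norm_fderiv_le' (𝕜 := ℝ) (s := segment ℝ (γ s) (δ s))
        (fun y hy => hX y (hsub hy)) (fun y hy => ?_) (convex_segment _ _)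
        (left_mem_segment _ _ _) (right_mem_segment _ _ _)
      refine (hlip y (hsub hy) _ (hγS s hs')).trans ?_
      gcongr
      exact norm_sub_le_of_mem_segment hy
    have h3 : ‖δ s - γ s‖ ≤ L * ‖h‖ := hclose s hs'
    have h4 : (C * ‖δ s - γ s‖) * ‖δ s - γ s‖ ≤ C * L ^ 2 * ‖h‖ ^ 2 := by
      calc (C * ‖δ s - γ s‖) * ‖δ s - γ s‖ ≤ (C * (L * ‖h‖)) * (L * ‖h‖) := by gcongr
        _ = _ := by ring
    have h5 : X (δ s) - X (γ s) - fderiv ℝ X (γ s) (N s h) =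
        fderiv ℝ X (γ s) (δ s - γ s - N s h) +
          (X (δ s) - X (γ s) - fderiv ℝ X (γ s) (δ s - γ s)) := by
      simp only [map_sub]; abel
    rw [h5]
    refine (norm_add_le _ _).trans (add_le_add ?_ (h2.trans h4))
    exact (ContinuousLinearMap.le_opNorm _ _).trans
      (mul_le_mul_of_nonneg_right (hbound _ (hγS s hs')) (norm_nonneg _))

/-- A `C²` vector field has a local flow `φ` which is differentiable in the initial value; its
derivative `M` is continuous and solves the variational equation. -/
theorem exists_local_flow [CompleteSpace E] {X : E → E} {x₀ : E} (hX : ContDiffAt ℝ 2 X x₀)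
    {O : Set E} (hO : O ∈ 𝓝 x₀) :
    ∃ ε > 0, ∃ W, IsOpen W ∧ x₀ ∈ W ∧ ∃ φ : E → ℝ → E, ∃ M : E → ℝ → E →L[ℝ] E,
      (∀ x ∈ W, φ x 0 = x ∧ M x 0 = ContinuousLinearMap.id ℝ E ∧ ∀ t ∈ Set.Icc 0 ε, φ x t ∈ O ∧
        HasDerivWithinAt (φ x) (X (φ x t)) (Set.Icc 0 ε) t ∧
        HasDerivWithinAt (M x) ((fderiv ℝ X (φ x t)).comp (M x t)) (Set.Icc 0 ε) t) ∧
      ∀ t ∈ Set.Icc 0 ε, ContinuousOn (fun x => M x t) W ∧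
        ∀ x ∈ W, HasFDerivAt (fun x => φ x t) (M x t) x := by
  have hX' : ContDiffAt ℝ 1 (fderiv ℝ X) x₀ := hX.fderiv_right (by norm_num)
  -- The flow and its derivative together solve an ODE on `E × (E →L[ℝ] E)`, whose field is `C¹`.
  let Y : E × (E →L[ℝ] E) → E × (E →L[ℝ] E) := fun p => (X p.1, (fderiv ℝ X p.1).comp p.2)
  let y₀ : E × (E →L[ℝ] E) := (x₀, ContinuousLinearMap.id ℝ E)
  have hY : ContDiffAt ℝ 1 Y y₀ := by
    refine ContDiffAt.prodMk ?_ ?_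
    · exact (hX.of_le (by norm_num)).comp y₀ contDiffAt_fst
    · exact (ContDiffAt.comp y₀ (g := fderiv ℝ X) hX' contDiffAt_fst).clm_comp contDiffAt_snd
  obtain ⟨e, he, a, r, L, K, hr, hPL⟩ := IsPicardLindelof.of_contDiffAt_one hY
  obtain ⟨α, hα, L', hL'⟩ :=
    (hPL 0).exists_forall_mem_closedBall_eq_hasDerivWithinAt_lipschitzOnWith
  simp only [zero_sub, zero_add] at hα hL'
  have hcont : ContinuousOn (Function.uncurry α) (Metric.closedBall y₀ r ×ˢ Set.Icc (-e) e) :=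
    continuousOn_prod_of_continuousOn_lipschitzOnWith _ L'
      (fun x hx t ht => ((hα x hx).2 t ht).continuousWithinAt) hL'
  -- a ball on which `X` is differentiable and `fderiv ℝ X` is bounded and Lipschitz
  obtain ⟨C, s, hs, hC⟩ := hX'.exists_lipschitzOnWith
  have hdiff : ∀ᶠ y in 𝓝 x₀, DifferentiableAt ℝ X y :=
    (hX.eventually (by norm_num)).mono fun y hy => hy.differentiableAt (by norm_num)
  have hbd : ∀ᶠ y in 𝓝 x₀, ‖fderiv ℝ X y‖ < ‖fderiv ℝ X x₀‖ + 1 :=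
    hX'.continuousAt.norm.eventually_lt_const (by linarith)
  obtain ⟨ρ, hρ, hball⟩ := Metric.mem_nhds_iff.mp
    (Filter.inter_mem (Filter.inter_mem hs hO) (Filter.inter_mem hdiff hbd))
  have hy₀ : ((y₀, (0 : ℝ)) : (E × (E →L[ℝ] E)) × ℝ) ∈ Metric.closedBall y₀ r ×ˢ Set.Icc (-e) e :=
    ⟨Metric.mem_closedBall_self r.2, by simp [he.le]⟩
  have hnhds : Metric.closedBall y₀ r ×ˢ Set.Icc (-e) e ∈ 𝓝 ((y₀, (0 : ℝ))) :=
    prod_mem_nhds (Metric.closedBall_mem_nhds _ (by exact_mod_cast hr))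
      (Icc_mem_nhds (by linarith) he)
  have hev : ∀ᶠ p in 𝓝 ((y₀, (0 : ℝ))), (Function.uncurry α p).1 ∈ Metric.ball x₀ ρ := by
    have h1 : ContinuousAt (fun p => (Function.uncurry α p).1) (y₀, (0 : ℝ)) :=
      continuous_fst.continuousAt.comp (hcont.continuousAt hnhds)
    refine h1 (Metric.isOpen_ball.mem_nhds ?_)
    have : α y₀ 0 = y₀ := (hα y₀ hy₀.1).1
    simp only [Function.uncurry_apply_pair, this]
    exact Metric.mem_ball_self hρ
  rw [nhds_prod_eq, Filter.eventually_prod_iff] at hev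
  obtain ⟨p, hp, q, hq, hpq⟩ := hev
  obtain ⟨ε₁, hε₁, hqε⟩ := Metric.eventually_nhds_iff.mp hq
  have hι : Filter.Tendsto (fun x : E => ((x, ContinuousLinearMap.id ℝ E) : E × (E →L[ℝ] E)))
      (𝓝 x₀) (𝓝 y₀) :=
    (by fun_prop : Continuous fun x : E => (x, ContinuousLinearMap.id ℝ E)).tendsto x₀
  have hW : ∀ᶠ x in 𝓝 x₀, (x, ContinuousLinearMap.id ℝ E) ∈ Metric.closedBall y₀ (r : ℝ) ∧
      p (x, ContinuousLinearMap.id ℝ E) :=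
    hι.eventually (Filter.Eventually.and
      (Metric.closedBall_mem_nhds (α := E × (E →L[ℝ] E)) y₀ (by exact_mod_cast hr)) hp)
  obtain ⟨W, hWsub, hWo, hxW⟩ := mem_nhds_iff.mp hW
  refine ⟨min e (ε₁ / 2), by positivity, W, hWo, hxW,
    fun x t => (α (x, ContinuousLinearMap.id ℝ E) t).1,
    fun x t => (α (x, ContinuousLinearMap.id ℝ E) t).2, ?_, ?_⟩
  all_goals
    set ε := min e (ε₁ / 2) with hεdef
    have hIcc : Set.Icc 0 ε ⊆ Set.Icc (-e) e :=
      Set.Icc_subset_Icc (by linarith) (min_le_left _ _)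
    have hin : ∀ x ∈ W, ∀ t ∈ Set.Icc 0 ε,
        (α (x, ContinuousLinearMap.id ℝ E) t).1 ∈ Metric.ball x₀ ρ := by
      intro x hx t ht
      refine hpq (hWsub hx).2 (hqε ?_)
      rw [Real.dist_eq, sub_zero, abs_of_nonneg ht.1]
      linarith [ht.2, min_le_right e (ε₁ / 2)]
    have h0 : ∀ x ∈ W, α (x, ContinuousLinearMap.id ℝ E) 0 = (x, ContinuousLinearMap.id ℝ E) :=
      fun x hx => (hα _ (hWsub hx).1).1
    have hD : ∀ x ∈ W, ∀ t ∈ Set.Icc 0 ε,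
        HasDerivWithinAt (fun t => (α (x, ContinuousLinearMap.id ℝ E) t).1)
          (X (α (x, ContinuousLinearMap.id ℝ E) t).1) (Set.Icc 0 ε) t ∧
        HasDerivWithinAt (fun t => (α (x, ContinuousLinearMap.id ℝ E) t).2)
          ((fderiv ℝ X (α (x, ContinuousLinearMap.id ℝ E) t).1).comp
            (α (x, ContinuousLinearMap.id ℝ E) t).2) (Set.Icc 0 ε) t := by
      intro x hx t ht
      have h1 := ((hα _ (hWsub hx).1).2 t (hIcc ht)).mono hIcc
      exact ⟨h1.fst, h1.snd⟩
  · intro x hx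
    refine ⟨by simp [h0 x hx], by simp [h0 x hx], fun t ht => ⟨?_, (hD x hx t ht).1,
      (hD x hx t ht).2⟩⟩
    exact (hball (hin x hx t ht)).1.2
  · intro t ht
    refine ⟨?_, fun x hx => ?_⟩
    · have h1 : ContinuousOn (fun x : E => α (x, ContinuousLinearMap.id ℝ E) t) W :=
        (hL' t (hIcc ht)).continuousOn.comp
          (by fun_prop : Continuous fun x : E => (x, ContinuousLinearMap.id ℝ E)).continuousOn
          (fun x hx => (hWsub hx).1)
      exact continuous_snd.comp_continuousOn h1
    · set K' := ‖fderiv ℝ X x₀‖ + 1 with hK'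
      have hmain : ∀ x' ∈ W, ‖(α (x', ContinuousLinearMap.id ℝ E) t).1 -
          (α (x, ContinuousLinearMap.id ℝ E) t).1 -
          (α (x, ContinuousLinearMap.id ℝ E) t).2 (x' - x)‖ ≤
          ((C : ℝ) * (L' : ℝ) ^ 2 / K' * (Real.exp (K' * t) - 1)) * ‖x' - x‖ ^ 2 := by
        intro x' hx'
        have := norm_sub_variational_le (X := X) (S := Metric.ball x₀ ρ) (convex_ball _ _)
          (fun y hy => (hball hy).2.1) (K := K') (C := C) (L := L') (ε := ε) (by positivity)
          (by positivity) (fun y hy => (hball hy).2.2.le) (by positivity)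
          (fun y hy y' hy' => hC.norm_sub_le (hball hy).1.1 (hball hy').1.1)
          (γ := fun t => (α (x, ContinuousLinearMap.id ℝ E) t).1)
          (δ := fun t => (α (x', ContinuousLinearMap.id ℝ E) t).1)
          (N := fun t => (α (x, ContinuousLinearMap.id ℝ E) t).2)
          (hin x hx) (hin x' hx') (fun s hs => (hD x hx s hs).1) (fun s hs => (hD x' hx' s hs).1)
          (fun s hs => (hD x hx s hs).2) (by simp [h0 x hx]) ?_ t ht
        · simpa [h0 x hx, h0 x' hx'] using this
        · intro s hs
          have h1 := (hL' s (hIcc hs)).norm_sub_le (hWsub hx').1 (hWsub hx).1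
          have h2 : ‖((x', ContinuousLinearMap.id ℝ E) : E × (E →L[ℝ] E)) -
              (x, ContinuousLinearMap.id ℝ E)‖ = ‖x' - x‖ := by simp [Prod.norm_def]
          rw [h2] at h1
          simp only [h0 x hx, h0 x' hx']
          exact (norm_fst_le (α (x', ContinuousLinearMap.id ℝ E) s -
            α (x, ContinuousLinearMap.id ℝ E) s)).trans h1
      rw [hasFDerivAt_iff_isLittleO]
      have hO1 : (fun x' => (α (x', ContinuousLinearMap.id ℝ E) t).1 -
          (α (x, ContinuousLinearMap.id ℝ E) t).1 -
          (α (x, ContinuousLinearMap.id ℝ E) t).2 (x' - x)) =O[𝓝 x]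
          fun x' => ‖x' - x‖ ^ 2 := by
        refine Asymptotics.IsBigO.of_bound
          ((C : ℝ) * (L' : ℝ) ^ 2 / K' * (Real.exp (K' * t) - 1)) ?_
        filter_upwards [hWo.mem_nhds hx] with x' hx'
        simpa using hmain x' hx'
      refine hO1.trans_isLittleO ?_
      have := (Asymptotics.isLittleO_norm_pow_id (E' := E) one_lt_two).comp_tendsto
        (show Filter.Tendsto (fun x' => x' - x) (𝓝 x) (𝓝 0) by
          simpa using (continuous_sub_right x).tendsto x)
      simpa [Function.comp_def] using this

end LocalFlow

variable {n : ℕ}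

/-! ### Flow relations -/

theorem FlowRel.congr {Ω : Set (Phase n)} {X Y : Phase n → Phase n} (h : Set.EqOn X Y Ω) {t : ℝ}
    {z w : Phase n} (hz : FlowRel Ω X t z w) : FlowRel Ω Y t z w := by
  obtain ⟨γ, h0, ht, hγ, hΩ⟩ := hz
  exact ⟨γ, h0, ht, fun s hs => by simpa only [h (hΩ s hs)] using hγ s hs, hΩ⟩

theorem flowRel_congr {Ω : Set (Phase n)} {X Y : Phase n → Phase n} (h : Set.EqOn X Y Ω) (t : ℝ) :
    FlowRel Ω X t = FlowRel Ω Y t := by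
  funext z w
  exact propext ⟨FlowRel.congr h, FlowRel.congr h.symm⟩

theorem FlowRel.left_mem {Ω : Set (Phase n)} {X : Phase n → Phase n} {t : ℝ} {z w : Phase n}
    (h : FlowRel Ω X t z w) : z ∈ Ω := by
  obtain ⟨γ, rfl, -, -, hΩ⟩ := h
  exact hΩ 0 Set.left_mem_uIcc

theorem FlowRel.right_mem {Ω : Set (Phase n)} {X : Phase n → Phase n} {t : ℝ} {z w : Phase n}
    (h : FlowRel Ω X t z w) : w ∈ Ω := by
  obtain ⟨γ, -, rfl, -, hΩ⟩ := h
  exact hΩ t Set.right_mem_uIcc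

theorem flowRel_zero {Ω : Set (Phase n)} (X : Phase n → Phase n) {z : Phase n} (hz : z ∈ Ω) :
    FlowRel Ω X 0 z z := by
  refine ⟨fun _ => z, rfl, rfl, fun s hs => ?_, fun _ _ => hz⟩
  rw [Set.uIcc_self] at hs ⊢
  rw [Set.mem_singleton_iff.mp hs]
  exact hasDerivWithinAt_iff_hasFDerivWithinAt.mpr
    (HasFDerivWithinAt.of_subsingleton Set.subsingleton_singleton)

theorem FlowRel.smul {Ω : Set (Phase n)} {X : Phase n → Phase n} {s t : ℝ} {z w : Phase n}
    (h : FlowRel Ω X (s * t) z w) : FlowRel Ω (s • X) t z w := by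
  obtain ⟨γ, h0, ht, hγ, hΩ⟩ := h
  have hmap : Set.MapsTo (fun u => s * u) (Set.uIcc 0 t) (Set.uIcc 0 (s * t)) := by
    intro u hu
    have : s * u ∈ (fun x => s * x) '' Set.uIcc 0 t := ⟨u, hu, rfl⟩
    simpa [Set.image_const_mul_uIcc] using this
  refine ⟨fun u => γ (s * u), by simpa using h0, ht, fun u hu => ?_, fun u hu => hΩ _ (hmap hu)⟩
  have h1 : HasDerivWithinAt (fun u => s * u) s (Set.uIcc 0 t) u := by
    simpa using ((hasDerivAt_id u).const_mul s).hasDerivWithinAt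
  exact (hγ (s * u) (hmap hu)).scomp u h1 hmap

theorem eq_of_hasDerivWithinAt_zero {F : Type*} [NormedAddCommGroup F] [NormedSpace ℝ F]
    {f : ℝ → F} {t : ℝ} (hf : ∀ s ∈ Set.uIcc 0 t, HasDerivWithinAt f 0 (Set.uIcc 0 t) s)
    {s : ℝ} (hs : s ∈ Set.uIcc 0 t) : f s = f 0 := by
  have := (convex_uIcc (0 : ℝ) t).norm_image_sub_le_of_norm_hasDerivWithin_le (C := 0) hf
    (by simp) Set.left_mem_uIcc hs
  rw [zero_mul] at this
  exact sub_eq_zero.mp (norm_le_zero_iff.mp this)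

/-- Multiplying a vector field by a constant rescales the time of its flow. -/
theorem flowRel_smul (Ω : Set (Phase n)) (X : Phase n → Phase n) (s t : ℝ) :
    FlowRel Ω (s • X) t = FlowRel Ω X (s * t) := by
  funext z w
  refine propext ⟨fun h => ?_, FlowRel.smul⟩
  rcases eq_or_ne s 0 with rfl | hs
  · obtain ⟨γ, rfl, rfl, hγ, hΩ⟩ := h
    have hconst : γ t = γ 0 := eq_of_hasDerivWithinAt_zero
      (fun u hu => by simpa using hγ u hu) Set.right_mem_uIcc
    rw [hconst, zero_mul]
    exact flowRel_zero X (hΩ 0 Set.left_mem_uIcc)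
  · have h1 : FlowRel Ω (s⁻¹ • (s • X)) (s * t) z w :=
      FlowRel.smul (by rwa [← mul_assoc, inv_mul_cancel₀ hs, one_mul])
    rwa [smul_smul, inv_mul_cancel₀ hs, one_smul] at h1

theorem flowRel_neg (Ω : Set (Phase n)) (X : Phase n → Phase n) (t : ℝ) :
    FlowRel Ω (-X) t = FlowRel Ω X (-t) := by
  simpa using flowRel_smul Ω X (-1) t

/-- Running an integral curve backwards. -/
theorem FlowRel.flip {Ω : Set (Phase n)} {X : Phase n → Phase n} {t : ℝ} {z w : Phase n}
    (h : FlowRel Ω X t z w) : FlowRel Ω X (-t) w z := by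
  obtain ⟨γ, h0, ht, hγ, hΩ⟩ := h
  have hmap : Set.MapsTo (fun u => u + t) (Set.uIcc 0 (-t)) (Set.uIcc 0 t) := by
    intro u hu
    have : u + t ∈ (fun x => x + t) '' Set.uIcc 0 (-t) := ⟨u, hu, rfl⟩
    rw [Set.image_add_const_uIcc] at this
    simpa [Set.uIcc_comm] using this
  refine ⟨fun u => γ (u + t), by simpa using ht, by simpa using h0, fun u hu => ?_,
    fun u hu => hΩ _ (hmap hu)⟩
  have h1 : HasDerivWithinAt (fun u => u + t) 1 (Set.uIcc 0 (-t)) u :=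
    ((hasDerivAt_id u).add_const t).hasDerivWithinAt
  have h2 := (hγ (u + t) (hmap hu)).scomp u h1 hmap
  rwa [one_smul] at h2

/-- The local flows form a semigroup. -/
theorem FlowRel.trans {Ω : Set (Phase n)} {X : Phase n → Phase n} {s t : ℝ} (hs : 0 ≤ s)
    (ht : 0 ≤ t) {z w v : Phase n} (h : FlowRel Ω X s z w) (h' : FlowRel Ω X t w v) :
    FlowRel Ω X (s + t) z v := by
  obtain ⟨γ, h0, h1, hγ, hΩ⟩ := h
  obtain ⟨δ, h0', h1', hδ, hΩ'⟩ := h'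
  rw [Set.uIcc_of_le hs] at hγ hΩ
  rw [Set.uIcc_of_le ht] at hδ hΩ'
  have hst : 0 ≤ s + t := add_nonneg hs ht
  set η : ℝ → Phase n := fun u => if u ≤ s then γ u else δ (u - s) with hη
  have e1 : Set.EqOn η γ (Set.Icc 0 s) := fun u hu => if_pos hu.2
  have e2 : Set.EqOn η (fun u => δ (u - s)) (Set.Icc s (s + t)) := by
    intro u hu
    rcases hu.1.eq_or_lt with rfl | hlt
    · simp [hη, h1, h0']
    · exact if_neg (not_le.mpr hlt)
  have hsub : ∀ u ∈ Set.Icc s (s + t), u - s ∈ Set.Icc 0 t := fun u hu =>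
    ⟨by linarith [hu.1], by linarith [hu.2]⟩
  have d1 : ∀ u ∈ Set.Icc 0 s, HasDerivWithinAt η (X (η u)) (Set.Icc 0 s) u := by
    intro u hu
    rw [e1 hu]
    exact (hγ u hu).congr e1 (e1 hu)
  have d2 : ∀ u ∈ Set.Icc s (s + t), HasDerivWithinAt η (X (η u)) (Set.Icc s (s + t)) u := by
    intro u hu
    rw [e2 hu]
    have h2 : HasDerivWithinAt (fun u => u - s) 1 (Set.Icc s (s + t)) u :=
      ((hasDerivAt_id u).sub_const s).hasDerivWithinAt
    have h3 := (hδ (u - s) (hsub u hu)).scomp u h2 hsub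
    rw [one_smul] at h3
    exact h3.congr e2 (e2 hu)
  refine ⟨η, ?_, ?_, ?_, ?_⟩
  · rw [e1 ⟨le_rfl, hs⟩, h0]
  · rw [e2 ⟨by linarith, le_rfl⟩]
    simpa using h1'
  · rw [Set.uIcc_of_le hst]
    intro u hu
    rw [← Set.Icc_union_Icc_eq_Icc hs (by linarith : s ≤ s + t)]
    -- at a point outside one of the two closed intervals there is nothing to check on it
    have d : ∀ I : Set ℝ, IsClosed I → (u ∈ I → HasDerivWithinAt η (X (η u)) I u) →
        HasDerivWithinAt η (X (η u)) I u := by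
      intro I hI h
      by_cases huI : u ∈ I
      · exact h huI
      · exact hasDerivWithinAt_iff_hasFDerivWithinAt.mpr
          (HasFDerivWithinAt.of_notMem_closure (by rwa [hI.closure_eq]))
    exact (d _ isClosed_Icc (d1 u)).union (d _ isClosed_Icc (d2 u))
  · rw [Set.uIcc_of_le hst]
    intro u hu
    rcases le_total u s with h | h
    · rw [e1 ⟨hu.1, h⟩]; exact hΩ u ⟨hu.1, h⟩
    · rw [e2 ⟨h, hu.2⟩]; exact hΩ' _ (hsub u ⟨h, hu.2⟩)

/-- Uniqueness of solutions of a `C¹` differential equation, forward in time. -/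
theorem integralCurveOn_eqOn {Ω : Set (Phase n)} (hΩ : IsOpen Ω) {X : Phase n → Phase n}
    (hX : ContDiffOn ℝ 1 X Ω) {t : ℝ} {γ δ : ℝ → Phase n}
    (hγ : IsIntegralCurveOn γ (fun _ => X) (Set.Icc 0 t))
    (hδ : IsIntegralCurveOn δ (fun _ => X) (Set.Icc 0 t)) (hγΩ : ∀ s ∈ Set.Icc 0 t, γ s ∈ Ω)
    (hδΩ : ∀ s ∈ Set.Icc 0 t, δ s ∈ Ω) (h0 : γ 0 = δ 0) : Set.EqOn γ δ (Set.Icc 0 t) := by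
  -- `X` is Lipschitz on the compact set traced out by the two curves
  have hcpt : IsCompact (γ '' Set.Icc 0 t ∪ δ '' Set.Icc 0 t) :=
    (isCompact_Icc.image_of_continuousOn hγ.continuousOn).union
      (isCompact_Icc.image_of_continuousOn hδ.continuousOn)
  have hsub : γ '' Set.Icc 0 t ∪ δ '' Set.Icc 0 t ⊆ Ω := by
    rintro _ (⟨s, hs, rfl⟩ | ⟨s, hs, rfl⟩)
    exacts [hγΩ s hs, hδΩ s hs]
  have hloc : LocallyLipschitzOn (γ '' Set.Icc 0 t ∪ δ '' Set.Icc 0 t) X := by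
    intro x hx
    obtain ⟨K, s, hs, hK⟩ :=
      (hX.contDiffAt (hΩ.mem_nhds (hsub hx))).exists_lipschitzOnWith
    exact ⟨K, s, mem_nhdsWithin_of_mem_nhds hs, hK⟩
  obtain ⟨K, hK⟩ := hloc.exists_lipschitzOnWith_of_compact hcpt
  exact ODE_solution_unique_of_mem_Icc_right (v := fun _ => X)
    (s := fun _ => γ '' Set.Icc 0 t ∪ δ '' Set.Icc 0 t) (fun _ _ => hK)
    hγ.continuousOn
    (fun s hs => (hγ s ⟨hs.1, hs.2.le⟩).mono_of_mem_nhdsWithin (Icc_mem_nhdsGE_of_mem hs))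
    (fun s hs => Or.inl ⟨s, ⟨hs.1, hs.2.le⟩, rfl⟩)
    hδ.continuousOn
    (fun s hs => (hδ s ⟨hs.1, hs.2.le⟩).mono_of_mem_nhdsWithin (Icc_mem_nhdsGE_of_mem hs))
    (fun s hs => Or.inr ⟨s, ⟨hs.1, hs.2.le⟩, rfl⟩) h0

theorem FlowRel.unique {Ω : Set (Phase n)} (hΩ : IsOpen Ω) {X : Phase n → Phase n}
    (hX : ContDiffOn ℝ 1 X Ω) {t : ℝ} {z w w' : Phase n} (h : FlowRel Ω X t z w)
    (h' : FlowRel Ω X t z w') : w = w' := by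
  wlog ht : 0 ≤ t generalizing t X
  · have e := flowRel_neg Ω X (-t)
    rw [neg_neg] at e
    exact this hX.neg (e ▸ h) (e ▸ h') (by linarith)
  obtain ⟨γ, h0, rfl, hγ, hγΩ⟩ := h
  obtain ⟨δ, h0', rfl, hδ, hδΩ⟩ := h'
  rw [Set.uIcc_of_le ht] at hγ hγΩ hδ hδΩ
  exact integralCurveOn_eqOn hΩ hX hγ hδ hγΩ hδΩ (h0.trans h0'.symm) ⟨ht, le_rfl⟩

/-! ### Symplectic relations -/

/-- The symplectic form `uᵀ J v` of phase space. -/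
def sympForm (u v : Phase n) : ℝ :=
  ∑ i, (u (Sum.inr i) * v (Sum.inl i) - u (Sum.inl i) * v (Sum.inr i))

theorem sympForm_eq (u v : Phase n) :
    u ⬝ᵥ (Matrix.J (Fin n) ℝ).mulVec v = sympForm u v := by
  rw [sympForm, Finset.sum_sub_distrib, Matrix.J, Matrix.fromBlocks_mulVec, dotProduct,
    Fintype.sum_sum_type]
  simp [Matrix.neg_mulVec, sub_eq_neg_add]

theorem transpose_mul_J_mul_eq_of_sympForm {f : Phase n → Phase n} {z : Phase n}
    (h : ∀ u v, sympForm (fderiv ℝ f z u) (fderiv ℝ f z v) = sympForm u v) :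
    (jacobian f z).transpose * Matrix.J (Fin n) ℝ * jacobian f z = Matrix.J (Fin n) ℝ := by
  have h1 : ∀ u, (jacobian f z).mulVec u = fderiv ℝ f z u := fun u =>
    LinearMap.toMatrix'_mulVec (fderiv ℝ f z : Phase n →ₗ[ℝ] Phase n) u
  have h2 : ∀ (A : Matrix (Fin n ⊕ Fin n) (Fin n ⊕ Fin n) ℝ) i j,
      A i j = Pi.single i 1 ⬝ᵥ A.mulVec (Pi.single j 1) := fun A i j => by simp
  ext i j
  refine (h2 _ i j).trans (Eq.trans ?_ (h2 _ i j).symm)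
  rw [sympForm_eq, ← h, ← sympForm_eq, ← h1, ← h1,
    ← Matrix.mulVec_mulVec, ← Matrix.mulVec_mulVec, Matrix.dotProduct_mulVec _ (Matrix.transpose _),
    Matrix.vecMul_transpose]

/-- Near the pair `(z, w)` the relation `r` contains the graph of a map which is `C¹` at `z` and
whose derivative at `z` preserves the symplectic form. -/
def IsLocallySymplecticAt (r : Phase n → Phase n → Prop) (z w : Phase n) : Prop :=
  ∃ f : Phase n → Phase n, ContDiffAt ℝ 1 f z ∧ f z = w ∧ (∀ᶠ z' in 𝓝 z, r z' (f z')) ∧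
    ∀ u v, sympForm (fderiv ℝ f z u) (fderiv ℝ f z v) = sympForm u v

theorem IsLocallySymplecticAt.rel {r : Phase n → Phase n → Prop} {z w : Phase n}
    (h : IsLocallySymplecticAt r z w) : r z w := by
  obtain ⟨f, -, rfl, h, -⟩ := h
  exact h.self_of_nhds

theorem IsLocallySymplecticAt.mono {r r' : Phase n → Phase n → Prop} {z w : Phase n}
    (h : IsLocallySymplecticAt r z w) (hr : ∀ z w, r z w → r' z w) :
    IsLocallySymplecticAt r' z w := by
  obtain ⟨f, hf, hw, hrel, hs⟩ := h
  exact ⟨f, hf, hw, hrel.mono fun z' h => hr _ _ h, hs⟩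

theorem isLocallySymplecticAt_eq (z : Phase n) : IsLocallySymplecticAt Eq z z :=
  ⟨id, contDiffAt_id, rfl, Filter.Eventually.of_forall fun _ => rfl, fun u v => by simp⟩

theorem IsLocallySymplecticAt.comp {r r' : Phase n → Phase n → Prop} {z w v : Phase n}
    (h : IsLocallySymplecticAt r z w) (h' : IsLocallySymplecticAt r' w v) :
    IsLocallySymplecticAt (Relation.Comp r r') z v := by
  obtain ⟨f, hf, rfl, hrel, hs⟩ := h
  obtain ⟨g, hg, rfl, hrel', hs'⟩ := h'
  refine ⟨g ∘ f, hg.comp z hf, rfl, ?_, fun u v => ?_⟩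
  · filter_upwards [hrel, hf.continuousAt.eventually hrel'] with z' h1 h2
    exact ⟨f z', h1, h2⟩
  · rw [fderiv_comp z (hg.differentiableAt (by norm_num)) (hf.differentiableAt (by norm_num))]
    simp only [ContinuousLinearMap.coe_comp, Function.comp_apply, hs', hs]

/-! ### Flows of infinitesimally symplectic vector fields -/

/-- The derivative of the vector field `X` is skew-adjoint for the symplectic form at every point
of `Ω`. -/
def IsInfinitesimallySymplecticOn (X : Phase n → Phase n) (Ω : Set (Phase n)) : Prop :=
  ∀ z ∈ Ω, ∀ u v, sympForm (fderiv ℝ X z u) v + sympForm u (fderiv ℝ X z v) = 0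

theorem sympForm_neg_left (u v : Phase n) : sympForm (-u) v = -sympForm u v := by
  simp only [sympForm, Pi.neg_apply, ← Finset.sum_neg_distrib]
  exact Finset.sum_congr rfl fun i _ => by ring

theorem sympForm_neg_right (u v : Phase n) : sympForm u (-v) = -sympForm u v := by
  simp only [sympForm, Pi.neg_apply, ← Finset.sum_neg_distrib]
  exact Finset.sum_congr rfl fun i _ => by ring

theorem IsInfinitesimallySymplecticOn.neg {X : Phase n → Phase n} {Ω : Set (Phase n)}
    (h : IsInfinitesimallySymplecticOn X Ω) : IsInfinitesimallySymplecticOn (-X) Ω := by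
  intro z hz u v
  rw [fderiv_neg]
  simp only [neg_apply, sympForm_neg_left, sympForm_neg_right]
  linarith [h z hz u v]

theorem hasDerivWithinAt_sympForm {u v : ℝ → Phase n} {u' v' : Phase n} {s : Set ℝ} {t : ℝ}
    (hu : HasDerivWithinAt u u' s t) (hv : HasDerivWithinAt v v' s t) :
    HasDerivWithinAt (fun t => sympForm (u t) (v t)) (sympForm u' (v t) + sympForm (u t) v') s t := by
  rw [hasDerivWithinAt_pi] at hu hv
  have := HasDerivWithinAt.fun_sum (u := Finset.univ) fun i _ =>
    ((hu (Sum.inr i)).mul (hv (Sum.inl i))).sub ((hu (Sum.inl i)).mul (hv (Sum.inr i)))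
  refine this.congr_deriv ?_
  simp only [sympForm, ← Finset.sum_add_distrib]
  exact Finset.sum_congr rfl fun i _ => by ring

/-- For short times, uniformly near a given point, the flow is defined, stays close to the
point, and is symplectic. -/
theorem exists_isLocallySymplecticAt_flowRel {Ω : Set (Phase n)} (hΩ : IsOpen Ω)
    {X : Phase n → Phase n} (hX : ContDiffOn ℝ 2 X Ω) (hs : IsInfinitesimallySymplecticOn X Ω)
    {x₀ : Phase n} (hx₀ : x₀ ∈ Ω) {O : Set (Phase n)} (hO : O ∈ 𝓝 x₀) :
    ∃ ε > 0, ∃ W, IsOpen W ∧ x₀ ∈ W ∧ ∀ x ∈ W, ∀ t ∈ Set.Icc 0 ε, ∃ w ∈ O,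
      IsLocallySymplecticAt (FlowRel Ω X t) x w := by
  obtain ⟨ε, hε, W, hWo, hxW, φ, M, h1, h2⟩ := exists_local_flow
    (hX.contDiffAt (hΩ.mem_nhds hx₀)) (Filter.inter_mem hO (hΩ.mem_nhds hx₀))
  refine ⟨ε, hε, W, hWo, hxW, fun x hx t ht => ⟨φ x t, ((h1 x hx).2.2 t ht).1.1,
    fun x => φ x t, ?_, rfl, ?_, ?_⟩⟩
  · exact contDiffAt_one_iff.mpr ⟨fun x => M x t, W, hWo.mem_nhds hx, (h2 t ht).1, (h2 t ht).2⟩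
  · filter_upwards [hWo.mem_nhds hx] with x' hx'
    have hsub : Set.uIcc 0 t ⊆ Set.Icc 0 ε := by
      rw [Set.uIcc_of_le ht.1]; exact Set.Icc_subset_Icc le_rfl ht.2
    exact ⟨φ x', (h1 x' hx').1, rfl, fun s hs => ((h1 x' hx').2.2 s (hsub hs)).2.1.mono hsub,
      fun s hs => ((h1 x' hx').2.2 s (hsub hs)).1.2⟩
  · intro u v
    rw [((h2 t ht).2 x hx).fderiv]
    have hd : ∀ s ∈ Set.Icc 0 ε, HasDerivWithinAt (fun s => sympForm (M x s u) (M x s v)) 0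
        (Set.Icc 0 ε) s := by
      intro s hs'
      have hM := ((h1 x hx).2.2 s hs').2.2
      have hu := hM.clm_apply (hasDerivWithinAt_const s (Set.Icc 0 ε) u)
      have hv := hM.clm_apply (hasDerivWithinAt_const s (Set.Icc 0 ε) v)
      simp only [ContinuousLinearMap.coe_comp, Function.comp_apply, map_zero, add_zero] at hu hv
      have := hasDerivWithinAt_sympForm hu hv
      rwa [hs _ ((h1 x hx).2.2 s hs').1.2] at this
    have := constant_of_has_deriv_right_zero (fun s hs => (hd s hs).continuousWithinAt)
      (fun s hs => (hd s ⟨hs.1, hs.2.le⟩).mono_of_mem_nhdsWithin (Icc_mem_nhdsGE_of_mem hs)) t ht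
    simpa [(h1 x hx).2.1] using this

theorem FlowRel.isLocallySymplecticAt_of_nonneg {Ω : Set (Phase n)} (hΩ : IsOpen Ω)
    {X : Phase n → Phase n} (hX : ContDiffOn ℝ 2 X Ω) (hs : IsInfinitesimallySymplecticOn X Ω)
    {t : ℝ} (ht : 0 ≤ t) {z w : Phase n} (h : FlowRel Ω X t z w) :
    IsLocallySymplecticAt (FlowRel Ω X t) z w := by
  have hX1 : ContDiffOn ℝ 1 X Ω := hX.of_le (by norm_num)
  obtain ⟨γ, rfl, rfl, hγ, hγΩ⟩ := h
  rw [Set.uIcc_of_le ht] at hγ hγΩ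
  -- by compactness of the curve there is a time up to which the flow exists near all its points
  obtain ⟨ε, hε, hunif⟩ : ∃ ε > 0, ∀ y ∈ γ '' Set.Icc 0 t, ∀ h ∈ Set.Icc 0 ε, ∃ w,
      IsLocallySymplecticAt (FlowRel Ω X h) y w := by
    refine (isCompact_Icc.image_of_continuousOn hγ.continuousOn).induction_on
      (p := fun S => ∃ ε > 0, ∀ y ∈ S, ∀ h ∈ Set.Icc 0 ε, ∃ w,
        IsLocallySymplecticAt (FlowRel Ω X h) y w) ?_ ?_ ?_ ?_
    · exact ⟨1, one_pos, by simp⟩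
    · rintro S T hST ⟨ε, hε, h⟩
      exact ⟨ε, hε, fun y hy => h y (hST hy)⟩
    · rintro S T ⟨ε, hε, h⟩ ⟨ε', hε', h'⟩
      refine ⟨min ε ε', lt_min hε hε', ?_⟩
      rintro y (hy | hy) u hu
      · exact h y hy u ⟨hu.1, hu.2.trans (min_le_left _ _)⟩
      · exact h' y hy u ⟨hu.1, hu.2.trans (min_le_right _ _)⟩
    · rintro _ ⟨s, hs', rfl⟩
      obtain ⟨ε, hε, W, hWo, hW, h⟩ := exists_isLocallySymplecticAt_flowRel hΩ hX hs
        (hγΩ s hs') Filter.univ_mem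
      refine ⟨W, mem_nhdsWithin_of_mem_nhds (hWo.mem_nhds hW), ε, hε, fun y hy u hu => ?_⟩
      obtain ⟨w, -, hw⟩ := h y hy u hu
      exact ⟨w, hw⟩
  have hrel : ∀ s ∈ Set.Icc 0 t, FlowRel Ω X s (γ 0) (γ s) := by
    intro s hs'
    have hsub : Set.uIcc 0 s ⊆ Set.Icc 0 t := by
      rw [Set.uIcc_of_le hs'.1]; exact Set.Icc_subset_Icc le_rfl hs'.2
    exact ⟨γ, rfl, rfl, hγ.mono hsub, fun u hu => hγΩ u (hsub hu)⟩
  have key : ∀ k : ℕ, ∀ s ∈ Set.Icc 0 t, s ≤ k * ε →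
      IsLocallySymplecticAt (FlowRel Ω X s) (γ 0) (γ s) := by
    intro k
    induction k with
    | zero =>
      intro s hs' hsk
      obtain rfl : s = 0 := le_antisymm (by simpa using hsk) hs'.1
      obtain ⟨w, hw⟩ := hunif (γ 0) ⟨0, hs', rfl⟩ 0 ⟨le_rfl, hε.le⟩
      rwa [hw.rel.unique hΩ hX1 (hrel 0 hs')] at hw
    | succ k ih =>
      intro s hs' hsk
      push_cast at hsk
      -- step back by a time of at most `ε`, but not beyond the initial time
      set s₀ := max 0 (s - ε)
      have a1 : 0 ≤ s₀ := le_max_left _ _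
      have a2 : s₀ ≤ s := max_le hs'.1 (by linarith)
      have a3 : s₀ ≤ k * ε := max_le (by positivity) (by linarith)
      have a4 : s - s₀ ≤ ε := by linarith [le_max_right 0 (s - ε)]
      have hs₀t : s₀ ∈ Set.Icc 0 t := ⟨a1, a2.trans hs'.2⟩
      obtain ⟨w, hw⟩ := hunif (γ s₀) ⟨s₀, hs₀t, rfl⟩ (s - s₀) ⟨by linarith, a4⟩
      have hcomp := ((ih s₀ hs₀t a3).comp hw).mono (r' := FlowRel Ω X s) (by
        rintro x y ⟨m, h1, h2⟩
        have := h1.trans a1 (by linarith) h2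
        rwa [add_sub_cancel] at this)
      rwa [hcomp.rel.unique hΩ hX1 (hrel s hs')] at hcomp
  obtain ⟨k, hk⟩ := exists_nat_ge (t / ε)
  exact key k t ⟨ht, le_rfl⟩ ((div_le_iff₀ hε).mp hk)

/-- The flow of an infinitesimally symplectic vector field is symplectic, for all times for which
it is defined. -/
theorem FlowRel.isLocallySymplecticAt {Ω : Set (Phase n)} (hΩ : IsOpen Ω)
    {X : Phase n → Phase n} (hX : ContDiffOn ℝ 2 X Ω) (hs : IsInfinitesimallySymplecticOn X Ω)
    {t : ℝ} {z w : Phase n} (h : FlowRel Ω X t z w) :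
    IsLocallySymplecticAt (FlowRel Ω X t) z w := by
  rcases le_total 0 t with ht | ht
  · exact h.isLocallySymplecticAt_of_nonneg hΩ hX hs ht
  · have e := flowRel_neg Ω X (-t)
    rw [neg_neg] at e
    rw [← e] at h ⊢
    exact h.isLocallySymplecticAt_of_nonneg hΩ hX.neg hs.neg (by linarith)

theorem eventually_exists_flowRel {Ω : Set (Phase n)} (hΩ : IsOpen Ω)
    {X : Phase n → Phase n} (hX : ContDiffOn ℝ 2 X Ω) (hs : IsInfinitesimallySymplecticOn X Ω)
    {z : Phase n} (hz : z ∈ Ω) {O : Set (Phase n)} (hO : O ∈ 𝓝 z) :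
    ∀ᶠ p : ℝ × Phase n in 𝓝 (0, z), ∃ w ∈ O, FlowRel Ω X p.1 p.2 w := by
  obtain ⟨ε, hε, W, hWo, hW, h⟩ := exists_isLocallySymplecticAt_flowRel hΩ hX hs hz hO
  obtain ⟨ε', hε', W', hWo', hW', h'⟩ :=
    exists_isLocallySymplecticAt_flowRel hΩ hX.neg hs.neg hz hO
  filter_upwards [prod_mem_nhds (Ioo_mem_nhds (neg_lt_zero.mpr hε') hε)
    (Filter.inter_mem (hWo.mem_nhds hW) (hWo'.mem_nhds hW'))] with p hp
  rcases le_total 0 p.1 with h0 | h0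
  · obtain ⟨w, hw, hw'⟩ := h p.2 hp.2.1 p.1 ⟨h0, hp.1.2.le⟩
    exact ⟨w, hw, hw'.rel⟩
  · obtain ⟨w, hw, hw'⟩ := h' p.2 hp.2.2 (-p.1) ⟨by linarith, by linarith [hp.1.1]⟩
    have := hw'.rel
    rw [show (fun x => -X x) = -X from rfl, flowRel_neg, neg_neg] at this
    exact ⟨w, hw, this⟩

/-! ### Hamiltonian vector fields -/

/-- The projection `(q, p) ↦ q` as a continuous linear map. -/
def posL (n : ℕ) : Phase n →L[ℝ] (Fin n → ℝ) :=
  ContinuousLinearMap.pi fun i => ContinuousLinearMap.proj (Sum.inl i)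

theorem posL_apply (z : Phase n) : posL n z = pos z := rfl

theorem isOpen_phaseDomain {U : Set (Fin n → ℝ)} (hU : IsOpen U) : IsOpen (phaseDomain U) :=
  hU.preimage (posL n).continuous

theorem contDiffOn_lift {U : Set (Fin n → ℝ)} {m : WithTop ℕ∞} {W : (Fin n → ℝ) → ℝ}
    (hW : ContDiffOn ℝ m W U) : ContDiffOn ℝ m (lift W) (phaseDomain U) :=
  hW.comp (posL n).contDiff.contDiffOn fun _ hz => hz

theorem contDiffOn_pd {ι : Type} [Fintype ι] [DecidableEq ι] {U : Set (ι → ℝ)} (hU : IsOpen U)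
    {m k : WithTop ℕ∞} (hmk : m + 1 ≤ k) {f : (ι → ℝ) → ℝ} (hf : ContDiffOn ℝ k f U) (i : ι) :
    ContDiffOn ℝ m (pd i f) U :=
  (hf.fderiv_of_isOpen hU hmk).clm_apply contDiffOn_const

theorem fderiv_eq_sum_pd {ι : Type} [Fintype ι] [DecidableEq ι] (f : (ι → ℝ) → ℝ) (x v : ι → ℝ) :
    fderiv ℝ f x v = ∑ i, v i * pd i f x := by
  conv_lhs => rw [← Finset.univ_sum_single v]
  rw [map_sum]
  refine Finset.sum_congr rfl fun i _ => ?_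
  rw [pd, ← smul_eq_mul, ← map_smul, ← Pi.single_smul, smul_eq_mul, mul_one]

/-- Symmetry of second partial derivatives. -/
theorem pd_comm {ι : Type} [Fintype ι] [DecidableEq ι] {f : (ι → ℝ) → ℝ} {x : ι → ℝ}
    (hf : ContDiffAt ℝ 2 f x) (i j : ι) : pd i (pd j f) x = pd j (pd i f) x := by
  have hd : DifferentiableAt ℝ (fderiv ℝ f) x :=
    (hf.fderiv_right (m := 1) (by norm_num)).differentiableAt (by norm_num)
  have h : ∀ i j : ι, pd i (pd j f) x =
      fderiv ℝ (fderiv ℝ f) x (Pi.single i 1) (Pi.single j 1) := by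
    intro i j
    change fderiv ℝ (fun y => fderiv ℝ f y (Pi.single j 1)) x (Pi.single i 1) = _
    rw [fderiv_clm_apply hd (differentiableAt_const _)]
    simp
  rw [h, h]
  exact hf.isSymmSndFDerivAt (by simp) _ _

theorem contDiffOn_hamField {Ω : Set (Phase n)} (hΩ : IsOpen Ω) {m k : WithTop ℕ∞}
    (hmk : m + 1 ≤ k) {H : Phase n → ℝ} (hH : ContDiffOn ℝ k H Ω) :
    ContDiffOn ℝ m (hamField H) Ω := by
  refine contDiffOn_pi.mpr ?_
  rintro (i | i)
  · exact contDiffOn_pd hΩ hmk hH _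
  · exact (contDiffOn_pd hΩ hmk hH _).neg

/-- The derivative of a vector field, coordinate by coordinate. -/
theorem fderiv_apply_coord {X : Phase n → Phase n} {z : Phase n} (hX : DifferentiableAt ℝ X z)
    (u : Phase n) (i : Fin n ⊕ Fin n) : fderiv ℝ X z u i = fderiv ℝ (fun z => X z i) z u := by
  rw [fderiv_pi (differentiableAt_pi.mp hX)]
  rfl

theorem isInfinitesimallySymplecticOn_hamField {Ω : Set (Phase n)} (hΩ : IsOpen Ω)
    {H : Phase n → ℝ} (hH : ContDiffOn ℝ 2 H Ω) :
    IsInfinitesimallySymplecticOn (hamField H) Ω := by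
  intro z hz u v
  have hHz : ContDiffAt ℝ 2 H z := hH.contDiffAt (hΩ.mem_nhds hz)
  have hX : DifferentiableAt ℝ (hamField H) z :=
    ((contDiffOn_hamField hΩ (m := 1) (by norm_num) hH).contDiffAt
      (hΩ.mem_nhds hz)).differentiableAt (by norm_num)
  have hd : DifferentiableAt ℝ (fderiv ℝ H) z :=
    (hHz.fderiv_right (m := 1) (by norm_num)).differentiableAt (by norm_num)
  have hsnd : ∀ w u, fderiv ℝ (fun y => fderiv ℝ H y w) z u = fderiv ℝ (fderiv ℝ H) z u w := by
    intro w u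
    rw [fderiv_clm_apply hd (differentiableAt_const _)]
    simp
  have hl : ∀ u i, fderiv ℝ (hamField H) z u (Sum.inl i) =
      fderiv ℝ (fderiv ℝ H) z u (Pi.single (Sum.inr i) 1) := by
    intro u i
    rw [fderiv_apply_coord hX]
    exact hsnd _ _
  have hr : ∀ u i, fderiv ℝ (hamField H) z u (Sum.inr i) =
      -fderiv ℝ (fderiv ℝ H) z u (Pi.single (Sum.inl i) 1) := by
    intro u i
    rw [fderiv_apply_coord hX, ← hsnd]
    exact congrArg (fun L : Phase n →L[ℝ] ℝ => L u)
      (fderiv_fun_neg (f := fun y => fderiv ℝ H y (Pi.single (Sum.inl i) 1)))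
  -- both terms are values of the Hessian of `H`
  have hv : ∀ u v : Phase n, fderiv ℝ (fderiv ℝ H) z u v =
      ∑ i, (v (Sum.inl i) * fderiv ℝ (fderiv ℝ H) z u (Pi.single (Sum.inl i) 1) +
        v (Sum.inr i) * fderiv ℝ (fderiv ℝ H) z u (Pi.single (Sum.inr i) 1)) := by
    intro u v
    conv_lhs => rw [← Finset.univ_sum_single v]
    rw [map_sum, Fintype.sum_sum_type, ← Finset.sum_add_distrib]
    refine Finset.sum_congr rfl fun i _ => ?_
    congr 1 <;> rw [← smul_eq_mul, ← map_smul, ← Pi.single_smul, smul_eq_mul, mul_one]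
  have hsymm : fderiv ℝ (fderiv ℝ H) z u v = fderiv ℝ (fderiv ℝ H) z v u :=
    hHz.isSymmSndFDerivAt (by simp) _ _
  rw [hv u v, hv v u] at hsymm
  simp only [sympForm, hl, hr]
  rw [← sub_eq_zero, ← Finset.sum_sub_distrib] at hsymm
  rw [← Finset.sum_add_distrib, ← neg_eq_zero, ← Finset.sum_neg_distrib, ← hsymm]
  exact Finset.sum_congr rfl fun i _ => by ring

/-! ### The flow of a potential -/

theorem pd_inl_lift {W : (Fin n → ℝ) → ℝ} {z : Phase n} (hW : DifferentiableAt ℝ W (pos z))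
    (i : Fin n) : pd (Sum.inl i) (lift W) z = pd i W (pos z) := by
  have h : HasFDerivAt (lift W) ((fderiv ℝ W (pos z)).comp (posL n)) z :=
    HasFDerivAt.comp z hW.hasFDerivAt (posL n).hasFDerivAt
  rw [pd, h.fderiv, pd, ContinuousLinearMap.comp_apply]
  congr 1
  ext j
  simp [posL_apply, pos, Pi.single_apply]

theorem pd_inr_lift {W : (Fin n → ℝ) → ℝ} {z : Phase n} (hW : DifferentiableAt ℝ W (pos z))
    (i : Fin n) : pd (Sum.inr i) (lift W) z = 0 := by
  have h : HasFDerivAt (lift W) ((fderiv ℝ W (pos z)).comp (posL n)) z :=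
    HasFDerivAt.comp z hW.hasFDerivAt (posL n).hasFDerivAt
  rw [pd, h.fderiv, ContinuousLinearMap.comp_apply]
  convert map_zero (fderiv ℝ W (pos z)) using 2
  ext j
  simp [posL_apply, pos]

/-- The vector field of a potential is vertical and depends on the coordinates only. -/
theorem hamField_lift {W : (Fin n → ℝ) → ℝ} {z : Phase n} (hW : DifferentiableAt ℝ W (pos z)) :
    hamField (lift W) z = Sum.elim (fun _ => 0) (fun i => -pd i W (pos z)) := by
  ext (i | i)
  · exact pd_inr_lift hW i
  · exact congrArg Neg.neg (pd_inl_lift hW i)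

theorem pos_add_smul_hamField_lift {W : (Fin n → ℝ) → ℝ} {z : Phase n}
    (hW : DifferentiableAt ℝ W (pos z)) (t : ℝ) :
    pos (z + t • hamField (lift W) z) = pos z := by
  ext i
  simp [pos, hamField_lift hW]

theorem flowRel_hamField_lift_iff {U : Set (Fin n → ℝ)} (hU : IsOpen U) {W : (Fin n → ℝ) → ℝ}
    (hW : DifferentiableOn ℝ W U) {t : ℝ} {z w : Phase n} :
    FlowRel (phaseDomain U) (hamField (lift W)) t z w ↔
      z ∈ phaseDomain U ∧ w = z + t • hamField (lift W) z := by
  have hW' : ∀ z ∈ phaseDomain U, DifferentiableAt ℝ W (pos z) := fun z hz =>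
    hW.differentiableAt (hU.mem_nhds hz)
  have hdep : ∀ z z', z ∈ phaseDomain U → pos z' = pos z →
      hamField (lift W) z' = hamField (lift W) z := by
    intro z z' hz h
    rw [hamField_lift (hW' z hz), hamField_lift (h ▸ hW' z hz), h]
  constructor
  · rintro ⟨γ, rfl, rfl, hγ, hΩ⟩
    refine ⟨hΩ 0 Set.left_mem_uIcc, ?_⟩
    have hz := hΩ 0 Set.left_mem_uIcc
    have hpos : ∀ s ∈ Set.uIcc 0 t, pos (γ s) = pos (γ 0) := by
      intro s hs
      refine eq_of_hasDerivWithinAt_zero (f := fun s => pos (γ s)) (fun u hu => ?_) hs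
      rw [hasDerivWithinAt_pi]
      intro i
      have := (hasDerivWithinAt_pi.mp (hγ u hu)) (Sum.inl i)
      beta_reduce at this
      rwa [hamField_lift (hW' _ (hΩ u hu))] at this
    have : γ t - t • hamField (lift W) (γ 0) = γ 0 - (0 : ℝ) • hamField (lift W) (γ 0) := by
      refine eq_of_hasDerivWithinAt_zero (f := fun s => γ s - s • hamField (lift W) (γ 0))
        (fun u hu => ?_) Set.right_mem_uIcc
      have h1 := (hγ u hu).sub
        (((hasDerivAt_id u).smul_const (hamField (lift W) (γ 0))).hasDerivWithinAt)
      beta_reduce at h1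
      rwa [hdep _ _ hz (hpos u hu), one_smul, sub_self] at h1
    rw [zero_smul, sub_zero] at this
    exact sub_eq_iff_eq_add.mp this
  · rintro ⟨hz, rfl⟩
    have hpos := pos_add_smul_hamField_lift (hW' z hz)
    refine ⟨fun s => z + s • hamField (lift W) z, by simp, rfl, fun s _ => ?_, fun s _ => ?_⟩
    · beta_reduce
      rw [hdep z _ hz (hpos s)]
      have := ((hasDerivAt_id s).smul_const (hamField (lift W) z)).const_add z
      rw [one_smul] at this
      exact this.hasDerivWithinAt
    · change pos _ ∈ U
      rw [hpos]
      exact hz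

theorem FlowRel.isLocallySymplecticAt_lift {U : Set (Fin n → ℝ)} (hU : IsOpen U)
    {W : (Fin n → ℝ) → ℝ} (hW : ContDiffOn ℝ 2 W U) {t : ℝ} {z w : Phase n}
    (h : FlowRel (phaseDomain U) (hamField (lift W)) t z w) :
    IsLocallySymplecticAt (FlowRel (phaseDomain U) (hamField (lift W)) t) z w := by
  have hWd : DifferentiableOn ℝ W U := hW.differentiableOn (by norm_num)
  obtain ⟨hz, rfl⟩ := (flowRel_hamField_lift_iff hU hWd).mp h
  have hΩ := isOpen_phaseDomain hU
  have hX : ContDiffAt ℝ 1 (hamField (lift W)) z :=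
    (contDiffOn_hamField hΩ (by norm_num) (contDiffOn_lift hW)).contDiffAt (hΩ.mem_nhds hz)
  have hXd : DifferentiableAt ℝ (hamField (lift W)) z := hX.differentiableAt (by norm_num)
  refine ⟨fun z => z + t • hamField (lift W) z, contDiffAt_id.add (hX.const_smul t), rfl,
    ?_, fun u v => ?_⟩
  · filter_upwards [hΩ.mem_nhds hz] with z' hz'
    exact (flowRel_hamField_lift_iff hU hWd).mpr ⟨hz', rfl⟩
  · have hfd : fderiv ℝ (fun z => z + t • hamField (lift W) z) z =
        ContinuousLinearMap.id ℝ _ + t • fderiv ℝ (hamField (lift W)) z :=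
      ((hasFDerivAt_id z).add (hXd.hasFDerivAt.const_smul t)).fderiv
    have hvert : ∀ u i, fderiv ℝ (hamField (lift W)) z u (Sum.inl i) = 0 := by
      intro u i
      rw [fderiv_apply_coord hXd]
      have : (fun z => hamField (lift W) z (Sum.inl i)) =ᶠ[𝓝 z] fun _ => 0 := by
        filter_upwards [hΩ.mem_nhds hz] with z' hz'
        rw [hamField_lift (hWd.differentiableAt (hU.mem_nhds hz'))]
        rfl
      rw [this.fderiv_eq]
      simp
    have hskew := isInfinitesimallySymplecticOn_hamField hΩ (contDiffOn_lift hW) z hz u v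
    rw [hfd]
    simp only [sympForm, hvert, ← Finset.sum_add_distrib] at hskew ⊢
    simp only [add_apply, smul_apply, ContinuousLinearMap.coe_id', id_eq, Pi.add_apply,
      Pi.smul_apply, smul_eq_mul, hvert]
    have hskew' := congrArg (fun x => t * x) hskew
    beta_reduce at hskew'
    rw [mul_zero, Finset.mul_sum] at hskew'
    rw [← sub_eq_zero, ← Finset.sum_sub_distrib]
    refine Eq.trans ?_ hskew'
    exact Finset.sum_congr rfl fun i _ => by ring

/-! ### The Lie brackets -/

theorem pd_congr {ι : Type} [Fintype ι] [DecidableEq ι] {f g : (ι → ℝ) → ℝ} {s : Set (ι → ℝ)}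
    (hs : IsOpen s) (h : Set.EqOn f g s) {x : ι → ℝ} (hx : x ∈ s) (i : ι) :
    pd i f x = pd i g x := by
  rw [pd, pd, (h.eventuallyEq_of_mem (hs.mem_nhds hx)).fderiv_eq]

theorem fderiv_eq_of_hasDerivAt {ι : Type} [Fintype ι] {F : (ι → ℝ) → ℝ} {z v : ι → ℝ} {c : ℝ}
    (hF : DifferentiableAt ℝ F z) (h : HasDerivAt (fun s : ℝ => F (z + s • v)) c 0) :
    fderiv ℝ F z v = c := by
  rw [← hF.lineDeriv_eq_fderiv]
  exact h.deriv

theorem hasDerivAt_comp_line {ι : Type} [Fintype ι] [DecidableEq ι] {f : (ι → ℝ) → ℝ} {q : ι → ℝ}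
    (hf : DifferentiableAt ℝ f q) (i : ι) :
    HasDerivAt (fun s : ℝ => f (q + s • Pi.single i 1)) (pd i f q) 0 :=
  hf.hasFDerivAt.hasLineDerivAt _

/-- A tangent vector is vertical if its `q` components vanish. -/
def IsVertical (v : Phase n) : Prop := ∀ i, v (Sum.inl i) = 0

theorem IsVertical.pos_line {v : Phase n} (hv : IsVertical v) (z : Phase n) (s : ℝ) :
    pos (z + s • v) = pos z := by
  ext i; simp [pos, hv i]

theorem mom_line (z v : Phase n) (s : ℝ) (i : Fin n) :
    mom (z + s • v) i = mom z i + s * mom v i := rfl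

theorem hasDerivAt_mom_line (z v : Phase n) (i : Fin n) :
    HasDerivAt (fun s : ℝ => mom z i + s * mom v i) (mom v i) 0 := by
  simpa using ((hasDerivAt_id (0 : ℝ)).mul_const (mom v i)).const_add (mom z i)

theorem isVertical_single (i : Fin n) : IsVertical (Pi.single (Sum.inr i) 1 : Phase n) :=
  fun _ => by simp

theorem mom_single (i j : Fin n) :
    mom (Pi.single (Sum.inr i) 1 : Phase n) j = if j = i then 1 else 0 := by
  simp [mom, Pi.single_apply]

theorem contDiffOn_kinetic {U : Set (Fin n → ℝ)} {m : WithTop ℕ∞}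
    {a : Fin n → Fin n → (Fin n → ℝ) → ℝ} {b : Fin n → (Fin n → ℝ) → ℝ}
    (ha : ∀ i j, ContDiffOn ℝ m (a i j) U) (hb : ∀ i, ContDiffOn ℝ m (b i) U) :
    ContDiffOn ℝ m (kinetic a b) (phaseDomain U) := by
  have hp : ∀ i, ContDiffOn ℝ m (fun z : Phase n => mom z i) (phaseDomain U) := fun i =>
    (contDiff_apply ℝ ℝ (Sum.inr i : Fin n ⊕ Fin n)).contDiffOn
  refine ContDiffOn.add ?_ ?_
  · exact ContDiffOn.sum fun i _ => ContDiffOn.sum fun j _ =>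
      ((contDiffOn_lift (ha i j)).mul (hp i)).mul (hp j)
  · exact ContDiffOn.sum fun i _ => (contDiffOn_lift (hb i)).mul (hp i)

theorem fderiv_kinetic_of_isVertical {a : Fin n → Fin n → (Fin n → ℝ) → ℝ}
    {b : Fin n → (Fin n → ℝ) → ℝ} {z v : Phase n} (h : DifferentiableAt ℝ (kinetic a b) z)
    (hv : IsVertical v) :
    fderiv ℝ (kinetic a b) z v =
      (∑ j, ∑ k, a j k (pos z) * (mom v j * mom z k + mom z j * mom v k)) +
        ∑ j, b j (pos z) * mom v j := by
  refine fderiv_eq_of_hasDerivAt h ?_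
  simp only [kinetic, hv.pos_line, mom_line]
  have hp := hasDerivAt_mom_line z v
  refine (HasDerivAt.add
    (HasDerivAt.fun_sum (u := Finset.univ) fun j _ => HasDerivAt.fun_sum (u := Finset.univ)
      fun k _ => ((hp j).const_mul (a j k (pos z))).mul (hp k))
    (HasDerivAt.fun_sum (u := Finset.univ) fun j _ =>
      (hp j).const_mul (b j (pos z)))).congr_deriv ?_
  simp only [zero_mul, add_zero, mul_add, mul_assoc]

theorem pd_inl_kinetic {a : Fin n → Fin n → (Fin n → ℝ) → ℝ} {b : Fin n → (Fin n → ℝ) → ℝ}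
    {z : Phase n} (h : DifferentiableAt ℝ (kinetic a b) z)
    (ha : ∀ i j, DifferentiableAt ℝ (a i j) (pos z)) (hb : ∀ i, DifferentiableAt ℝ (b i) (pos z))
    (i : Fin n) :
    pd (Sum.inl i) (kinetic a b) z =
      kinetic (fun j k => pd i (a j k)) (fun j => pd i (b j)) z := by
  refine fderiv_eq_of_hasDerivAt h ?_
  have hpos : ∀ s : ℝ, pos (z + s • Pi.single (Sum.inl i) 1) = pos z + s • Pi.single i 1 := by
    intro s; ext j; simp [pos, Pi.single_apply]
  have hmom : ∀ s : ℝ, mom (z + s • Pi.single (Sum.inl i) 1) = mom z := by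
    intro s; ext j; simp [mom]
  simp only [kinetic, hpos, hmom]
  exact HasDerivAt.add
    (HasDerivAt.fun_sum (u := Finset.univ) fun j _ => HasDerivAt.fun_sum (u := Finset.univ)
      fun k _ => ((hasDerivAt_comp_line (ha j k) i).mul_const (mom z j)).mul_const (mom z k))
    (HasDerivAt.fun_sum (u := Finset.univ) fun j _ =>
      (hasDerivAt_comp_line (hb j) i).mul_const (mom z j))

theorem pd_inr_kinetic {a : Fin n → Fin n → (Fin n → ℝ) → ℝ} {b : Fin n → (Fin n → ℝ) → ℝ}
    {z : Phase n} (h : DifferentiableAt ℝ (kinetic a b) z) (i : Fin n) :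
    pd (Sum.inr i) (kinetic a b) z =
      ∑ j, (a i j (pos z) + a j i (pos z)) * mom z j + b i (pos z) := by
  rw [pd, fderiv_kinetic_of_isVertical h (isVertical_single i)]
  simp only [mom_single, mul_add, ite_mul, one_mul, zero_mul, mul_ite, mul_one, mul_zero,
    Finset.sum_add_distrib, Finset.sum_ite_eq', Finset.mem_univ, if_true, add_mul]
  congr 2
  rw [Finset.sum_comm]
  simp

section

variable {U : Set (Fin n → ℝ)} {a : Fin n → Fin n → (Fin n → ℝ) → ℝ} {b : Fin n → (Fin n → ℝ) → ℝ}
  {V : (Fin n → ℝ) → ℝ}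

theorem differentiableAt_of_contDiffOn_three {F : Type*} [NormedAddCommGroup F] [NormedSpace ℝ F]
    {U : Set F} (hU : IsOpen U) {f : F → ℝ} (hf : ContDiffOn ℝ 3 f U) {x : F} (hx : x ∈ U) :
    DifferentiableAt ℝ f x :=
  (hf.contDiffAt (hU.mem_nhds hx)).differentiableAt (by norm_num)

theorem opB_apply (hU : IsOpen U) (hV : ContDiffOn ℝ 3 V U) {z : Phase n}
    (hz : z ∈ phaseDomain U) :
    opB V z = Sum.elim (fun _ => 0) (fun i => -pd i V (pos z)) :=
  hamField_lift (differentiableAt_of_contDiffOn_three hU hV hz)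

theorem isVertical_opB (hU : IsOpen U) (hV : ContDiffOn ℝ 3 V U) {z : Phase n}
    (hz : z ∈ phaseDomain U) : IsVertical (opB V z) := fun i => by
  rw [opB_apply hU hV hz]; rfl

theorem mom_opB (hU : IsOpen U) (hV : ContDiffOn ℝ 3 V U) {z : Phase n}
    (hz : z ∈ phaseDomain U) (i : Fin n) : mom (opB V z) i = -pd i V (pos z) := by
  rw [mom, opB_apply hU hV hz]; rfl

theorem contDiffOn_opA (hU : IsOpen U) (ha : ∀ i j, ContDiffOn ℝ 3 (a i j) U)
    (hb : ∀ i, ContDiffOn ℝ 3 (b i) U) : ContDiffOn ℝ 2 (opA a b) (phaseDomain U) :=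
  contDiffOn_hamField (isOpen_phaseDomain hU) (by norm_num) (contDiffOn_kinetic ha hb)

theorem contDiffOn_opB (hU : IsOpen U) (hV : ContDiffOn ℝ 3 V U) :
    ContDiffOn ℝ 2 (opB V) (phaseDomain U) :=
  contDiffOn_hamField (isOpen_phaseDomain hU) (by norm_num) (contDiffOn_lift hV)

theorem fderiv_opB (hU : IsOpen U) (hV : ContDiffOn ℝ 3 V U) {z : Phase n}
    (hz : z ∈ phaseDomain U) (u : Phase n) :
    fderiv ℝ (opB V) z u =
      Sum.elim (fun _ => 0) (fun i => -∑ j, pos u j * pd j (pd i V) (pos z)) := by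
  have hΩ := isOpen_phaseDomain hU
  have hd : DifferentiableAt ℝ (opB V) z :=
    ((contDiffOn_opB hU hV).contDiffAt (hΩ.mem_nhds hz)).differentiableAt (by norm_num)
  ext (i | i)
  · rw [fderiv_apply_coord hd]
    have : (fun z => opB V z (Sum.inl i)) =ᶠ[𝓝 z] fun _ => 0 := by
      filter_upwards [hΩ.mem_nhds hz] with z' hz'
      exact isVertical_opB hU hV hz' i
    rw [this.fderiv_eq]
    simp
  · rw [fderiv_apply_coord hd]
    have : (fun z => opB V z (Sum.inr i)) =ᶠ[𝓝 z] fun z => -lift (pd i V) z := by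
      filter_upwards [hΩ.mem_nhds hz] with z' hz'
      exact mom_opB hU hV hz' i
    have hdV : DifferentiableAt ℝ (pd i V) (pos z) :=
      ((contDiffOn_pd hU (m := 2) (by norm_num) hV i).contDiffAt
        (hU.mem_nhds hz)).differentiableAt (by norm_num)
    rw [this.fderiv_eq, fderiv_fun_neg, neg_apply, fderiv_eq_sum_pd, Fintype.sum_sum_type]
    simp only [pd_inl_lift hdV, pd_inr_lift hdV, mul_zero, Finset.sum_const_zero, add_zero]
    rfl

/-- The bracket `[A, B]`. -/
theorem lieBracket_opA_opB (hU : IsOpen U) (ha : ∀ i j, ContDiffOn ℝ 3 (a i j) U)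
    (hb : ∀ i, ContDiffOn ℝ 3 (b i) U) (hV : ContDiffOn ℝ 3 V U) {z : Phase n}
    (hz : z ∈ phaseDomain U) :
    VectorField.lieBracket ℝ (opA a b) (opB V) z =
      Sum.elim (fun i => ∑ j, (a i j (pos z) + a j i (pos z)) * pd j V (pos z))
        (fun i => -(∑ j, (∑ k, (a j k (pos z) + a k j (pos z)) * mom z k + b j (pos z)) *
            pd j (pd i V) (pos z)) -
          ((∑ j, ∑ k, pd i (a j k) (pos z) *
              (pd j V (pos z) * mom z k + mom z j * pd k V (pos z))) +
            ∑ j, pd i (b j) (pos z) * pd j V (pos z))) := by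
  have hΩ := isOpen_phaseDomain hU
  have hK : ∀ z ∈ phaseDomain U, DifferentiableAt ℝ (kinetic a b) z := fun z hz =>
    differentiableAt_of_contDiffOn_three hΩ (contDiffOn_kinetic ha hb) hz
  have hd : DifferentiableAt ℝ (opA a b) z :=
    ((contDiffOn_opA hU ha hb).contDiffAt (hΩ.mem_nhds hz)).differentiableAt (by norm_num)
  have ha' : ∀ i j k, ContDiffOn ℝ 2 (pd i (a j k)) U := fun i j k =>
    contDiffOn_pd hU (by norm_num) (ha j k) i
  have hb' : ∀ i j, ContDiffOn ℝ 2 (pd i (b j)) U := fun i j =>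
    contDiffOn_pd hU (by norm_num) (hb j) i
  have hS : ∀ i j, ContDiffOn ℝ 3 (fun q => a i j q + a j i q) U := fun i j =>
    (ha i j).add (ha j i)
  have hvert := isVertical_opB hU hV hz
  have hmom := mom_opB hU hV hz
  have hpos : pos (opA a b z) = fun j => ∑ k, (a j k (pos z) + a k j (pos z)) * mom z k +
      b j (pos z) := by
    ext j
    exact pd_inr_kinetic (hK z hz) j
  rw [VectorField.lieBracket_eq]
  ext (i | i)
  · simp only [Pi.sub_apply, Sum.elim_inl]
    rw [fderiv_opB hU hV hz, fderiv_apply_coord hd]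
    -- the `q` components of `A` are affine in the momenta
    have : (fun z => opA a b z (Sum.inl i)) =ᶠ[𝓝 z]
        fun z => kinetic 0 (fun j q => a i j q + a j i q) z + lift (b i) z := by
      filter_upwards [hΩ.mem_nhds hz] with z' hz'
      refine (pd_inr_kinetic (hK z' hz') i).trans ?_
      simp [kinetic, lift]
    have hd1 : DifferentiableAt ℝ (kinetic 0 (fun j q => a i j q + a j i q)) z :=
      differentiableAt_of_contDiffOn_three hΩ
        (contDiffOn_kinetic (fun _ _ => contDiffOn_const) (fun j => hS i j)) hz
    have hd2 : DifferentiableAt ℝ (lift (b i)) z :=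
      differentiableAt_of_contDiffOn_three hΩ (contDiffOn_lift (hb i)) hz
    rw [this.fderiv_eq, fderiv_fun_add hd1 hd2, add_apply,
      fderiv_kinetic_of_isVertical hd1 hvert, fderiv_eq_sum_pd (lift (b i)), Fintype.sum_sum_type]
    have hvert' : ∀ i, opB V z (Sum.inl i) = 0 := hvert
    simp only [hvert', pd_inr_lift (differentiableAt_of_contDiffOn_three hU (hb i) hz), hmom]
    simp
  · simp only [Pi.sub_apply, Sum.elim_inr]
    rw [fderiv_opB hU hV hz, fderiv_apply_coord hd, hpos]
    have : (fun z => opA a b z (Sum.inr i)) =ᶠ[𝓝 z]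
        fun z => -kinetic (fun j k => pd i (a j k)) (fun j => pd i (b j)) z := by
      filter_upwards [hΩ.mem_nhds hz] with z' hz'
      exact congrArg Neg.neg (pd_inl_kinetic (hK z' hz')
        (fun j k => differentiableAt_of_contDiffOn_three hU (ha j k) hz')
        (fun j => differentiableAt_of_contDiffOn_three hU (hb j) hz') i)
    have hd1 : DifferentiableAt ℝ (kinetic (fun j k => pd i (a j k)) (fun j => pd i (b j))) z :=
      ((contDiffOn_kinetic (ha' i) (hb' i)).contDiffAt
        (hΩ.mem_nhds hz)).differentiableAt (by norm_num)
    rw [this.fderiv_eq, fderiv_fun_neg, neg_apply, fderiv_kinetic_of_isVertical hd1 hvert]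
    simp only [hmom, Sum.elim_inr, mul_neg, neg_mul, ← neg_add, Finset.sum_neg_distrib]
    ring

/-- The field `D = [B, [A, B]]` is vertical, and its momentum components do not depend on the
momenta. -/
theorem opD_apply (hU : IsOpen U) (ha : ∀ i j, ContDiffOn ℝ 3 (a i j) U)
    (hb : ∀ i, ContDiffOn ℝ 3 (b i) U) (hV : ContDiffOn ℝ 3 V U) {z : Phase n}
    (hz : z ∈ phaseDomain U) :
    opD a b V z = Sum.elim (fun _ => 0) (fun i =>
      ∑ j, ∑ k, (2 * pd j (pd i V) (pos z) * pd k V (pos z) * (a j k (pos z) + a k j (pos z)) +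
        pd j V (pos z) * pd k V (pos z) * (2 * pd i (a j k) (pos z)))) := by
  have hΩ := isOpen_phaseDomain hU
  have hvert := isVertical_opB hU hV hz
  have hmom := mom_opB hU hV hz
  have hd : DifferentiableAt ℝ (VectorField.lieBracket ℝ (opA a b) (opB V)) z := by
    have hA := (contDiffOn_opA hU ha hb).contDiffAt (hΩ.mem_nhds hz)
    have hB := (contDiffOn_opB hU hV).contDiffAt (hΩ.mem_nhds hz)
    exact (hA.lieBracket_vectorField hB (m := 1) (by norm_num)).differentiableAt (by norm_num)
  have hline : ∀ s : ℝ, z + s • opB V z ∈ phaseDomain U := fun s => by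
    change pos _ ∈ U
    rw [hvert.pos_line]; exact hz
  rw [opD, VectorField.lieBracket_eq]
  ext (i | i)
  · simp only [Pi.sub_apply, Sum.elim_inl]
    rw [fderiv_opB hU hV hz, fderiv_apply_coord hd, Sum.elim_inl, sub_zero]
    refine fderiv_eq_of_hasDerivAt (differentiableAt_pi.mp hd (Sum.inl i)) ?_
    simp only [fun s => lieBracket_opA_opB hU ha hb hV (hline s), hvert.pos_line, Sum.elim_inl]
    exact hasDerivAt_const _ _
  · simp only [Pi.sub_apply, Sum.elim_inr]
    have hp := hasDerivAt_mom_line z (opB V z)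
    rw [fderiv_opB hU hV hz, fderiv_apply_coord hd, Sum.elim_inr,
      fderiv_eq_of_hasDerivAt (differentiableAt_pi.mp hd (Sum.inr i)) (c :=
      -(∑ j, (∑ k, (a j k (pos z) + a k j (pos z)) * (-pd k V (pos z))) *
            pd j (pd i V) (pos z)) -
          (∑ j, ∑ k, pd i (a j k) (pos z) *
              (pd j V (pos z) * (-pd k V (pos z)) + (-pd j V (pos z)) * pd k V (pos z)))) ?_]
    · simp only [pos, lieBracket_opA_opB hU ha hb hV hz, Sum.elim_inl]
      simp only [sub_neg_eq_add, ← Finset.sum_neg_distrib, Finset.sum_mul,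
        ← Finset.sum_sub_distrib]
      refine Finset.sum_congr rfl fun j _ => Finset.sum_congr rfl fun k _ => ?_
      ring
    · simp only [fun s => lieBracket_opA_opB hU ha hb hV (hline s), hvert.pos_line, Sum.elim_inr,
        mom_line]
      simp only [hmom] at hp ⊢
      exact ((HasDerivAt.fun_sum (u := Finset.univ) fun j _ =>
        ((HasDerivAt.fun_sum (u := Finset.univ) fun k _ =>
          (hp k).const_mul (a j k (pos z) + a k j (pos z))).add_const _).mul_const _).neg).sub
        ((HasDerivAt.fun_sum (u := Finset.univ) fun j _ =>
          HasDerivAt.fun_sum (u := Finset.univ) fun k _ =>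
          (((hp k).const_mul (pd j V (pos z))).add
            ((hp j).mul_const (pd k V (pos z)))).const_mul _).add_const _)

theorem contDiffOn_potD (hU : IsOpen U) (ha : ∀ i j, ContDiffOn ℝ 3 (a i j) U)
    (hV : ContDiffOn ℝ 3 V U) : ContDiffOn ℝ 2 (potD a V) U := by
  have hV' : ∀ i, ContDiffOn ℝ 2 (pd i V) U := contDiffOn_pd hU (by norm_num) hV
  exact contDiffOn_const.mul (ContDiffOn.sum fun j _ => ContDiffOn.sum fun k _ =>
    (((ha j k).of_le (by norm_num)).mul (hV' j)).mul (hV' k))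

theorem pd_potD (hU : IsOpen U) (ha : ∀ i j, ContDiffOn ℝ 3 (a i j) U)
    (hV : ContDiffOn ℝ 3 V U) {q : Fin n → ℝ} (hq : q ∈ U) (i : Fin n) :
    pd i (potD a V) q = ∑ j, ∑ k, (2 * pd i (pd j V) q * pd k V q * (a j k q + a k j q) +
        pd j V q * pd k V q * (2 * pd i (a j k) q)) := by
  have hV' : ∀ j, DifferentiableAt ℝ (pd j V) q := fun j =>
    ((contDiffOn_pd hU (m := 2) (by norm_num) hV j).contDiffAt
      (hU.mem_nhds hq)).differentiableAt (by norm_num)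
  have hpotD : DifferentiableAt ℝ (potD a V) q :=
    ((contDiffOn_potD hU ha hV).contDiffAt (hU.mem_nhds hq)).differentiableAt (by norm_num)
  have hl := fun j => hasDerivAt_comp_line (hV' j) i
  have hla := fun j k =>
    hasDerivAt_comp_line (differentiableAt_of_contDiffOn_three hU (ha j k) hq) i
  have h : pd i (potD a V) q = 2 * ∑ j, ∑ k,
      ((pd i (a j k) q * pd j V q + a j k q * pd i (pd j V) q) * pd k V q +
        a j k q * pd j V q * pd i (pd k V) q) := by
    refine fderiv_eq_of_hasDerivAt hpotD ?_
    refine ((HasDerivAt.fun_sum (u := Finset.univ) fun j _ =>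
      HasDerivAt.fun_sum (u := Finset.univ) fun k _ =>
        ((hla j k).mul (hl j)).mul (hl k)).const_mul 2).congr_deriv ?_
    simp only [zero_smul, add_zero, Pi.mul_apply]
  -- exchange the summation indices in the term that differentiates the second factor
  have hswap : ∑ j, ∑ k, a j k q * pd j V q * pd i (pd k V) q =
      ∑ j, ∑ k, a k j q * pd k V q * pd i (pd j V) q := Finset.sum_comm
  simp only [Finset.sum_add_distrib, hswap] at h
  simp only [h, ← Finset.sum_add_distrib, Finset.mul_sum]
  refine Finset.sum_congr rfl fun j _ => Finset.sum_congr rfl fun k _ => ?_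
  ring

theorem pd_potD_eq_opD (hU : IsOpen U) (ha : ∀ i j, ContDiffOn ℝ 3 (a i j) U)
    (hb : ∀ i, ContDiffOn ℝ 3 (b i) U) (hV : ContDiffOn ℝ 3 V U) {z : Phase n}
    (hz : z ∈ phaseDomain U) (i : Fin n) :
    pd i (potD a V) (pos z) = opD a b V z (Sum.inr i) := by
  rw [pd_potD hU ha hV hz, opD_apply hU ha hb hV hz]
  simp only [Sum.elim_inr]
  refine Finset.sum_congr rfl fun j _ => Finset.sum_congr rfl fun k _ => ?_
  rw [pd_comm ((hV.of_le (by norm_num)).contDiffAt (hU.mem_nhds hz)) i j]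

theorem pd_pd_kinetic (hU : IsOpen U) (ha : ∀ i j, ContDiffOn ℝ 3 (a i j) U)
    (hb : ∀ i, ContDiffOn ℝ 3 (b i) U) (j k : Fin n) {z : Phase n} (hz : z ∈ phaseDomain U) :
    pd (Sum.inr j) (pd (Sum.inr k) (kinetic a b)) z = a j k (pos z) + a k j (pos z) := by
  have hΩ := isOpen_phaseDomain hU
  have hK : ∀ z ∈ phaseDomain U, DifferentiableAt ℝ (kinetic a b) z := fun z hz =>
    differentiableAt_of_contDiffOn_three hΩ (contDiffOn_kinetic ha hb) hz
  have hd : DifferentiableAt ℝ (pd (Sum.inr k) (kinetic a b)) z :=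
    ((contDiffOn_pd hΩ (m := 2) (by norm_num) (contDiffOn_kinetic ha hb) _).contDiffAt
      (hΩ.mem_nhds hz)).differentiableAt (by norm_num)
  have hline : ∀ s : ℝ, z + s • Pi.single (Sum.inr j) 1 ∈ phaseDomain U := fun s => by
    change pos _ ∈ U
    rw [(isVertical_single j).pos_line]; exact hz
  refine fderiv_eq_of_hasDerivAt hd ?_
  simp only [fun s => pd_inr_kinetic (hK _ (hline s)), (isVertical_single j).pos_line, mom_line]
  refine ((HasDerivAt.fun_sum (u := Finset.univ) fun l _ =>
    (hasDerivAt_mom_line z (Pi.single (Sum.inr j) 1) l).const_mul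
      (a k l (pos z) + a l k (pos z))).add_const _).congr_deriv ?_
  simp [mom_single, add_comm]

theorem pd_pd_pd_kinetic (hU : IsOpen U) (ha : ∀ i j, ContDiffOn ℝ 3 (a i j) U)
    (hb : ∀ i, ContDiffOn ℝ 3 (b i) U) (i j k : Fin n) {z : Phase n} (hz : z ∈ phaseDomain U) :
    pd (Sum.inl i) (pd (Sum.inr j) (pd (Sum.inr k) (kinetic a b))) z =
      pd i (a j k) (pos z) + pd i (a k j) (pos z) := by
  have hd := fun j k => differentiableAt_of_contDiffOn_three hU (ha j k) hz
  rw [pd_congr (isOpen_phaseDomain hU) (g := lift (fun q => a j k q + a k j q))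
    (fun z hz => pd_pd_kinetic hU ha hb j k hz) hz,
    pd_inl_lift (W := fun q => a j k q + a k j q) ((hd j k).add (hd k j)), pd, fderiv_fun_add (hd j k) (hd k j)]
  rfl

theorem opD_eq (hU : IsOpen U) (ha : ∀ i j, ContDiffOn ℝ 3 (a i j) U)
    (hb : ∀ i, ContDiffOn ℝ 3 (b i) U) (hV : ContDiffOn ℝ 3 V U) {z : Phase n}
    (hz : z ∈ phaseDomain U) (i : Fin n) :
    opD a b V z (Sum.inr i) = ∑ j, ∑ k,
      (2 * pd i (pd j V) (pos z) * pd k V (pos z) *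
          pd (Sum.inr j) (pd (Sum.inr k) (kinetic a b)) z +
        pd j V (pos z) * pd k V (pos z) *
          pd (Sum.inl i) (pd (Sum.inr j) (pd (Sum.inr k) (kinetic a b))) z) := by
  rw [← pd_potD_eq_opD hU ha hb hV hz, pd_potD hU ha hV hz]
  simp only [pd_pd_kinetic hU ha hb _ _ hz, pd_pd_pd_kinetic hU ha hb _ _ _ hz]
  have hswap : ∑ j, ∑ k, pd j V (pos z) * pd k V (pos z) * pd i (a k j) (pos z) =
      ∑ j, ∑ k, pd k V (pos z) * pd j V (pos z) * pd i (a j k) (pos z) := Finset.sum_comm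
  simp only [mul_add, Finset.sum_add_distrib, hswap]
  simp only [← Finset.sum_add_distrib]
  refine Finset.sum_congr rfl fun j _ => Finset.sum_congr rfl fun k _ => ?_
  ring

end

/-! ### From symplectic relations to symplectic maps -/

open Classical in
/-- The partial function with graph `r`, extended by the identity. -/
def relFun (r : Phase n → Phase n → Prop) (z : Phase n) : Phase n :=
  if h : ∃ w, r z w then h.choose else z

theorem relFun_eq {r : Phase n → Phase n → Prop} (hr : ∀ z w w', r z w → r z w' → w = w')
    {z w : Phase n} (h : r z w) : relFun r z = w := by
  have h' : ∃ w, r z w := ⟨w, h⟩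
  rw [relFun, dif_pos h']
  exact hr _ _ _ h'.choose_spec h

theorem isOpen_dom_of_isLocallySymplecticAt {r : Phase n → Phase n → Prop}
    (hs : ∀ z w, r z w → IsLocallySymplecticAt r z w) : IsOpen {z | ∃ w, r z w} := by
  rw [isOpen_iff_mem_nhds]
  rintro z ⟨w, h⟩
  obtain ⟨f, -, -, hf, -⟩ := hs z w h
  filter_upwards [hf] with z' hz'
  exact ⟨_, hz'⟩

theorem relFun_contDiffAt {r : Phase n → Phase n → Prop}
    (hr : ∀ z w w', r z w → r z w' → w = w') {z w : Phase n} (h : IsLocallySymplecticAt r z w) :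
    ContDiffAt ℝ 1 (relFun r) z ∧
      ∀ u v, sympForm (fderiv ℝ (relFun r) z u) (fderiv ℝ (relFun r) z v) = sympForm u v := by
  obtain ⟨f, hf, -, hrel, hs⟩ := h
  have he : relFun r =ᶠ[𝓝 z] f := hrel.mono fun z' hz' => relFun_eq hr hz'
  refine ⟨hf.congr_of_eventuallyEq he, ?_⟩
  rw [he.fderiv_eq]
  exact hs

/-- Two mutually inverse functional relations which are locally symplectic are the graphs of a
symplectic `C¹` map between open sets and of its inverse. -/
theorem exists_openPartialHomeomorph {r r' : Phase n → Phase n → Prop}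
    (hrr' : ∀ z w, r z w ↔ r' w z) (hr : ∀ z w w', r z w → r z w' → w = w')
    (hr' : ∀ z w w', r' z w → r' z w' → w = w')
    (hs : ∀ z w, r z w → IsLocallySymplecticAt r z w)
    (hs' : ∀ z w, r' z w → IsLocallySymplecticAt r' z w) :
    ∃ f : OpenPartialHomeomorph (Phase n) (Phase n),
      (∀ z w, r z w ↔ z ∈ f.source ∧ f z = w) ∧ ContDiffOn ℝ 1 f f.source ∧
      ∀ z ∈ f.source, (jacobian f z).transpose * Matrix.J (Fin n) ℝ * jacobian f z =
        Matrix.J (Fin n) ℝ ∧ (jacobian f z).det = 1 := by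
  let f : OpenPartialHomeomorph (Phase n) (Phase n) :=
    { toFun := relFun r
      invFun := relFun r'
      source := {z | ∃ w, r z w}
      target := {w | ∃ z, r' w z}
      map_source' := by
        rintro z ⟨w, h⟩
        exact ⟨z, (hrr' _ _).mp (by rwa [relFun_eq hr h])⟩
      map_target' := by
        rintro w ⟨z, h⟩
        exact ⟨w, (hrr' _ _).mpr (by rwa [relFun_eq hr' h])⟩
      left_inv' := by
        rintro z ⟨w, h⟩
        rw [relFun_eq hr h, relFun_eq hr' ((hrr' _ _).mp h)]
      right_inv' := by
        rintro w ⟨z, h⟩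
        rw [relFun_eq hr' h, relFun_eq hr ((hrr' _ _).mpr h)]
      open_source := isOpen_dom_of_isLocallySymplecticAt hs
      open_target := isOpen_dom_of_isLocallySymplecticAt hs'
      continuousOn_toFun := by
        rintro z ⟨w, h⟩
        exact (relFun_contDiffAt hr (hs z w h)).1.continuousAt.continuousWithinAt
      continuousOn_invFun := by
        rintro w ⟨z, h⟩
        exact (relFun_contDiffAt hr' (hs' w z h)).1.continuousAt.continuousWithinAt }
  refine ⟨f, fun z w => ⟨fun h => ⟨⟨w, h⟩, relFun_eq hr h⟩, ?_⟩, ?_, ?_⟩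
  · rintro ⟨⟨w', h⟩, rfl⟩
    change r z (relFun r z)
    rwa [relFun_eq hr h]
  · rintro z ⟨w, h⟩
    exact (relFun_contDiffAt hr (hs z w h)).1.contDiffWithinAt
  · rintro z ⟨w, h⟩
    have hJ := transpose_mul_J_mul_eq_of_sympForm (relFun_contDiffAt hr (hs z w h)).2
    exact ⟨hJ, SymplecticGroup.det_eq_one (SymplecticGroup.mem_iff'.mpr hJ)⟩

/-! ### Products of relations -/

theorem composeAll_append (l l' : List (Phase n → Phase n → Prop)) :
    composeAll (l ++ l') = Relation.Comp (composeAll l) (composeAll l') := by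
  induction l with
  | nil => simp [composeAll, Relation.eq_comp]
  | cons r l ih => simp [composeAll, ih, Relation.comp_assoc]

theorem composeAll_unique {l : List (Phase n → Phase n → Prop)}
    (h : ∀ r ∈ l, ∀ z w w', r z w → r z w' → w = w') {z w w' : Phase n}
    (hw : composeAll l z w) (hw' : composeAll l z w') : w = w' := by
  induction l generalizing z with
  | nil => exact hw.symm.trans hw'
  | cons r l ih =>
    obtain ⟨x, hx, hxw⟩ := hw
    obtain ⟨x', hx', hxw'⟩ := hw'
    obtain rfl := h r (by simp) z x x' hx hx'
    exact ih (fun r hr => h r (by simp [hr])) hxw hxw'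

theorem composeAll_isLocallySymplecticAt {l : List (Phase n → Phase n → Prop)}
    (h : ∀ r ∈ l, ∀ z w, r z w → IsLocallySymplecticAt r z w) {z w : Phase n}
    (hw : composeAll l z w) : IsLocallySymplecticAt (composeAll l) z w := by
  induction l generalizing z with
  | nil =>
    obtain rfl : z = w := hw
    exact isLocallySymplecticAt_eq z
  | cons r l ih =>
    obtain ⟨x, hx, hxw⟩ := hw
    exact (h r (by simp) z x hx).comp (ih (fun r hr => h r (by simp [hr])) hxw)

theorem composeAll_map_flip {σ : Type} (r r' : σ → Phase n → Phase n → Prop)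
    (h : ∀ s z w, r s z w → r' s w z) (l : List σ) {z w : Phase n}
    (hw : composeAll (l.map r) z w) : composeAll (l.reverse.map r') w z := by
  induction l generalizing z with
  | nil => exact Eq.symm hw
  | cons s l ih =>
    obtain ⟨x, hx, hxw⟩ := hw
    rw [List.reverse_cons, List.map_append, composeAll_append]
    exact ⟨x, ih hxw, z, h s z x hx, rfl⟩

theorem composeAll_map_eventually {σ : Type} {Ω : Set (Phase n)}
    (r : ℝ → σ → Phase n → Phase n → Prop)
    (h : ∀ s, ∀ z ∈ Ω, ∀ O ∈ 𝓝 z, ∀ᶠ p : ℝ × Phase n in 𝓝 (0, z), ∃ w ∈ O, r p.1 s p.2 w)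
    (l : List σ) {z : Phase n} (hz : z ∈ Ω) {O : Set (Phase n)} (hO : O ∈ 𝓝 z) :
    ∀ᶠ p : ℝ × Phase n in 𝓝 (0, z), ∃ w ∈ O, composeAll (l.map (r p.1)) p.2 w := by
  induction l with
  | nil =>
    filter_upwards [continuous_snd.continuousAt.preimage_mem_nhds (x := ((0 : ℝ), z)) hO] with p hp
    exact ⟨p.2, hp, rfl⟩
  | cons s l ih =>
    rw [nhds_prod_eq] at ih
    obtain ⟨P, hP, Q, hQ, hPQ⟩ := Filter.eventually_prod_iff.mp ih
    filter_upwards [h s z hz {x | Q x} hQ,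
      (continuous_fst.tendsto ((0 : ℝ), z)).eventually hP] with p hp hp1
    obtain ⟨x, hx, hpx⟩ := hp
    obtain ⟨w, hw, hxw⟩ := hPQ hp1 hx
    exact ⟨w, hw, x, hpx, hxw⟩

theorem composeAll_total {Ω : Set (Phase n)} {l : List (Phase n → Phase n → Prop)}
    (h : ∀ r ∈ l, ∀ z ∈ Ω, ∃ w ∈ Ω, r z w) {z : Phase n} (hz : z ∈ Ω) :
    ∃ w, composeAll l z w := by
  induction l generalizing z with
  | nil => exact ⟨z, rfl⟩
  | cons r l ih =>
    obtain ⟨x, hx, hzx⟩ := h r (by simp) z hz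
    obtain ⟨w, hw⟩ := ih (fun r hr => h r (by simp [hr])) hx
    exact ⟨w, x, hzx, hw⟩

/-! ### The factors of a composition scheme -/

section

variable {U : Set (Fin n → ℝ)} {a : Fin n → Fin n → (Fin n → ℝ) → ℝ} {b : Fin n → (Fin n → ℝ) → ℝ}
  {V : (Fin n → ℝ) → ℝ}

theorem contDiffOn_modPot (hU : IsOpen U) (ha : ∀ i j, ContDiffOn ℝ 3 (a i j) U)
    (hV : ContDiffOn ℝ 3 V U) (c τ : ℝ) : ContDiffOn ℝ 2 (modPot a V c τ) U :=
  (hV.of_le (by norm_num)).sub (contDiffOn_const.mul (contDiffOn_potD hU ha hV))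

theorem pd_modPot (hU : IsOpen U) (ha : ∀ i j, ContDiffOn ℝ 3 (a i j) U)
    (hV : ContDiffOn ℝ 3 V U) (c τ : ℝ) {q : Fin n → ℝ} (hq : q ∈ U) (i : Fin n) :
    pd i (modPot a V c τ) q = pd i V q - c * τ ^ 2 * pd i (potD a V) q := by
  have h1 : DifferentiableAt ℝ V q := differentiableAt_of_contDiffOn_three hU hV hq
  have h2 : DifferentiableAt ℝ (potD a V) q :=
    ((contDiffOn_potD hU ha hV).contDiffAt (hU.mem_nhds hq)).differentiableAt (by norm_num)
  have h : HasFDerivAt (modPot a V c τ)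
      (fderiv ℝ V q - (c * τ ^ 2) • fderiv ℝ (potD a V) q) q :=
    h1.hasFDerivAt.sub (h2.hasFDerivAt.const_mul (c * τ ^ 2))
  rw [pd, h.fderiv]
  rfl

/-- The vector field of a kick is the Hamiltonian field of the modified potential. -/
theorem opB_add_smul_opD_eqOn (hU : IsOpen U) (ha : ∀ i j, ContDiffOn ℝ 3 (a i j) U)
    (hb : ∀ i, ContDiffOn ℝ 3 (b i) U) (hV : ContDiffOn ℝ 3 V U) (c τ : ℝ) :
    Set.EqOn (opB V + (c * τ ^ 2) • opD a b V) (hamField (lift (modPot a V c τ)))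
      (phaseDomain U) := by
  intro z hz
  have hd : DifferentiableAt ℝ (modPot a V c τ) (pos z) :=
    ((contDiffOn_modPot hU ha hV c τ).contDiffAt (hU.mem_nhds hz)).differentiableAt (by norm_num)
  rw [hamField_lift hd]
  ext (i | i)
  · simp [opB_apply hU hV hz, opD_apply hU ha hb hV hz]
  · simp only [Sum.elim_inr, pd_modPot hU ha hV c τ hz, pd_potD_eq_opD hU ha hb hV hz]
    simp only [Pi.add_apply, Pi.smul_apply, smul_eq_mul, opB_apply hU hV hz, Sum.elim_inr]
    ring

theorem flowRel_modPot_iff (hU : IsOpen U) (ha : ∀ i j, ContDiffOn ℝ 3 (a i j) U)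
    (hV : ContDiffOn ℝ 3 V U) (c τ t : ℝ) (z w : Phase n) :
    FlowRel (phaseDomain U) (hamField (lift (modPot a V c τ))) t z w ↔
      z ∈ phaseDomain U ∧ pos w = pos z ∧
        ∀ i, mom w i = mom z i - t * (pd i V (pos z) - c * τ ^ 2 * pd i (potD a V) (pos z)) := by
  have hdiff : DifferentiableOn ℝ (modPot a V c τ) U :=
    (contDiffOn_modPot hU ha hV c τ).differentiableOn (by norm_num)
  rw [flowRel_hamField_lift_iff hU hdiff]
  refine and_congr_right fun hz => ?_
  have hd := hdiff.differentiableAt (hU.mem_nhds hz)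
  have hmom : ∀ i, (z + t • hamField (lift (modPot a V c τ)) z) (Sum.inr i) =
      mom z i - t * (pd i V (pos z) - c * τ ^ 2 * pd i (potD a V) (pos z)) := by
    intro i
    rw [← pd_modPot hU ha hV c τ hz]
    simp [hamField_lift hd, mom, sub_eq_add_neg]
  constructor
  · rintro rfl
    exact ⟨pos_add_smul_hamField_lift hd t, hmom⟩
  · rintro ⟨h1, h2⟩
    ext (i | i)
    · exact congrFun (h1.trans (pos_add_smul_hamField_lift hd t).symm) i
    · exact (h2 i).trans (hmom i).symm

theorem expRel_exponent (hU : IsOpen U) (ha : ∀ i j, ContDiffOn ℝ 3 (a i j) U)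
    (hb : ∀ i, ContDiffOn ℝ 3 (b i) U) (hV : ContDiffOn ℝ 3 V U) (c τ : ℝ) (s : Step) :
    ExpRel (phaseDomain U) (s.exponent a b V c τ) = s.exactFlow U a b V c τ := by
  cases s with
  | drift s => rw [ExpRel, Step.exponent, flowRel_smul, mul_one]; rfl
  | kick t =>
    rw [ExpRel, Step.exponent, flowRel_smul, mul_one,
      flowRel_congr (opB_add_smul_opD_eqOn hU ha hb hV c τ)]
    rfl

theorem integrator_eq_modifiedSplitting (hU : IsOpen U) (ha : ∀ i j, ContDiffOn ℝ 3 (a i j) U)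
    (hb : ∀ i, ContDiffOn ℝ 3 (b i) U) (hV : ContDiffOn ℝ 3 V U) (S : Scheme) (τ : ℝ) :
    S.integrator U a b V τ = S.modifiedSplitting U a b V τ := by
  rw [Scheme.integrator, Scheme.modifiedSplitting, Scheme.exponents, List.map_map]
  congr 1
  exact List.map_congr_left fun s _ => expRel_exponent hU ha hb hV S.c τ s

theorem exponents_neg (S : Scheme) (τ : ℝ) :
    S.exponents a b V (-τ) = (S.exponents a b V τ).map (fun X => -X) := by
  rw [Scheme.exponents, Scheme.exponents, List.map_map]
  refine List.map_congr_left fun s _ => ?_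
  cases s with
  | drift s => simp [Step.exponent, neg_smul]
  | kick t => simp only [Step.exponent, Function.comp_apply, mul_neg, neg_smul, neg_sq]

theorem exactFlow_left_mem {c τ : ℝ} {s : Step} {z w : Phase n}
    (h : s.exactFlow U a b V c τ z w) : z ∈ phaseDomain U := by
  cases s <;> exact FlowRel.left_mem h

theorem exactFlow_flip {c τ : ℝ} {s : Step} {z w : Phase n}
    (h : s.exactFlow U a b V c τ z w) : s.exactFlow U a b V c (-τ) w z := by
  cases s with
  | drift s => simpa [Step.exactFlow] using FlowRel.flip h
  | kick t =>
    have e : modPot a V c (-τ) = modPot a V c τ := by funext q; simp [modPot]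
    simpa [Step.exactFlow, e] using FlowRel.flip h

theorem exactFlow_unique (hU : IsOpen U) (ha : ∀ i j, ContDiffOn ℝ 3 (a i j) U)
    (hb : ∀ i, ContDiffOn ℝ 3 (b i) U) (hV : ContDiffOn ℝ 3 V U) {c τ : ℝ} {s : Step}
    {z w w' : Phase n} (h : s.exactFlow U a b V c τ z w) (h' : s.exactFlow U a b V c τ z w') :
    w = w' := by
  have hΩ := isOpen_phaseDomain hU
  cases s with
  | drift s => exact FlowRel.unique hΩ ((contDiffOn_opA hU ha hb).of_le (by norm_num)) h h'
  | kick t =>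
    exact FlowRel.unique hΩ (contDiffOn_hamField hΩ (by norm_num)
      (contDiffOn_lift (contDiffOn_modPot hU ha hV c τ))) h h'

theorem exactFlow_isLocallySymplecticAt (hU : IsOpen U) (ha : ∀ i j, ContDiffOn ℝ 3 (a i j) U)
    (hb : ∀ i, ContDiffOn ℝ 3 (b i) U) (hV : ContDiffOn ℝ 3 V U) {c τ : ℝ} {s : Step}
    {z w : Phase n} (h : s.exactFlow U a b V c τ z w) :
    IsLocallySymplecticAt (s.exactFlow U a b V c τ) z w := by
  have hΩ := isOpen_phaseDomain hU
  cases s with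
  | drift s =>
    exact FlowRel.isLocallySymplecticAt hΩ (contDiffOn_opA hU ha hb)
      (isInfinitesimallySymplecticOn_hamField hΩ
        ((contDiffOn_kinetic ha hb).of_le (by norm_num))) h
  | kick t => exact FlowRel.isLocallySymplecticAt_lift hU (contDiffOn_modPot hU ha hV c τ) h

theorem exactFlow_eventually (hU : IsOpen U) (ha : ∀ i j, ContDiffOn ℝ 3 (a i j) U)
    (hb : ∀ i, ContDiffOn ℝ 3 (b i) U) (hV : ContDiffOn ℝ 3 V U) (c : ℝ) (s : Step)
    {z : Phase n} (hz : z ∈ phaseDomain U) {O : Set (Phase n)} (hO : O ∈ 𝓝 z) :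
    ∀ᶠ p : ℝ × Phase n in 𝓝 (0, z), ∃ w ∈ O, s.exactFlow U a b V c p.1 p.2 w := by
  have hΩ := isOpen_phaseDomain hU
  cases s with
  | drift s =>
    have h := eventually_exists_flowRel hΩ (contDiffOn_opA hU ha hb)
      (isInfinitesimallySymplecticOn_hamField hΩ
        ((contDiffOn_kinetic ha hb).of_le (by norm_num))) hz hO
    have hcont : Filter.Tendsto (fun p : ℝ × Phase n => (s * p.1, p.2)) (𝓝 (0, z)) (𝓝 (0, z)) := by
      simpa using (by fun_prop : Continuous fun p : ℝ × Phase n => (s * p.1, p.2)).tendsto (0, z)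
    exact hcont.eventually h
  | kick t =>
    -- the kick is an explicit map, which is jointly continuous in `τ` and the phase point
    have hg : ∀ i, ContinuousAt (fun p : ℝ × Phase n => pd i V (pos p.2)) (0, z) := fun i =>
      ContinuousAt.comp (g := pd i V) (f := fun p : ℝ × Phase n => pos p.2)
        (((contDiffOn_pd hU (m := 2) (by norm_num) hV i).contDiffAt
          (hU.mem_nhds hz)).continuousAt)
        ((posL n).continuous.comp continuous_snd).continuousAt
    have hgD : ∀ i, ContinuousAt (fun p : ℝ × Phase n => pd i (potD a V) (pos p.2)) (0, z) :=
      fun i => ContinuousAt.comp (g := pd i (potD a V)) (f := fun p : ℝ × Phase n => pos p.2)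
        (((contDiffOn_pd hU (m := 1) (by norm_num) (contDiffOn_potD hU ha hV) i).contDiffAt
          (hU.mem_nhds hz)).continuousAt)
        ((posL n).continuous.comp continuous_snd).continuousAt
    let F : ℝ × Phase n → Phase n := fun p => Sum.elim (fun i => pos p.2 i) (fun i =>
      mom p.2 i - t * p.1 * (pd i V (pos p.2) - c * p.1 ^ 2 * pd i (potD a V) (pos p.2)))
    have hF : ContinuousAt F (0, z) := by
      rw [continuousAt_pi]
      rintro (i | i)
      · exact ((continuous_apply (Sum.inl i)).comp continuous_snd).continuousAt
      · exact (((continuous_apply (Sum.inr i)).comp continuous_snd).continuousAt).sub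
          ((by fun_prop : Continuous fun p : ℝ × Phase n => t * p.1).continuousAt.mul
            ((hg i).sub ((by fun_prop :
              Continuous fun p : ℝ × Phase n => c * p.1 ^ 2).continuousAt.mul (hgD i))))
    have hF0 : F (0, z) = z := by
      ext (i | i) <;> simp [F, pos, mom]
    have hΩ' : ∀ᶠ p : ℝ × Phase n in 𝓝 (0, z), p.2 ∈ phaseDomain U :=
      (continuous_snd.tendsto ((0 : ℝ), z)).eventually (hΩ.mem_nhds hz)
    filter_upwards [hF.preimage_mem_nhds (hF0.symm ▸ hO), hΩ'] with p hp hpΩ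
    exact ⟨F p, hp, (flowRel_modPot_iff hU ha hV _ _ _ _ _).mpr ⟨hpΩ, rfl, fun i => rfl⟩⟩

theorem exactFlow_total (hU : IsOpen U) (ha : ∀ i j, ContDiffOn ℝ 3 (a i j) U)
    (hV : ContDiffOn ℝ 3 V U) (hcomplete : ∀ t : ℝ, ∀ z ∈ phaseDomain U, ∃ w,
      FlowRel (phaseDomain U) (hamField (kinetic a b)) t z w) (c τ : ℝ) (s : Step)
    {z : Phase n} (hz : z ∈ phaseDomain U) :
    ∃ w ∈ phaseDomain U, s.exactFlow U a b V c τ z w := by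
  cases s with
  | drift s =>
    obtain ⟨w, hw⟩ := hcomplete (s * τ) z hz
    exact ⟨w, hw.right_mem, hw⟩
  | kick t =>
    have h := (flowRel_hamField_lift_iff hU ((contDiffOn_modPot hU ha hV c τ).differentiableOn
      (by norm_num)) (t := t * τ) (z := z)).mpr ⟨hz, rfl⟩
    exact ⟨_, h.right_mem, h⟩

/-- Every palindromic composition scheme with at least one factor is a symmetric symplectic
integrator. -/
theorem exists_integrator_openPartialHomeomorph (hU : IsOpen U)
    (ha : ∀ i j, ContDiffOn ℝ 3 (a i j) U) (hb : ∀ i, ContDiffOn ℝ 3 (b i) U)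
    (hV : ContDiffOn ℝ 3 V U) (S : Scheme) (hne : S.steps ≠ [])
    (hpal : S.steps.reverse = S.steps) :
    ∃ N : ℝ → OpenPartialHomeomorph (Phase n) (Phase n),
      (∀ τ z w, S.integrator U a b V τ z w ↔ z ∈ (N τ).source ∧ N τ z = w) ∧
      (∀ τ, (N τ).source ⊆ phaseDomain U) ∧
      (∀ z ∈ phaseDomain U, ∀ᶠ τ in 𝓝 (0 : ℝ), z ∈ (N τ).source) ∧
      ((∀ t : ℝ, ∀ z ∈ phaseDomain U, ∃ w,
          FlowRel (phaseDomain U) (hamField (kinetic a b)) t z w) →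
        ∀ τ, (N τ).source = phaseDomain U ∧ (N τ).target = phaseDomain U) ∧
      (∀ τ, ContDiffOn ℝ 1 (N τ) (N τ).source ∧
        ∀ z ∈ (N τ).source,
          (jacobian (N τ) z).transpose * Matrix.J (Fin n) ℝ * jacobian (N τ) z =
            Matrix.J (Fin n) ℝ ∧
          (jacobian (N τ) z).det = 1) ∧
      (∀ τ, (N (-τ)).source = (N τ).target ∧
        ∀ z ∈ (N (-τ)).source, N (-τ) z ∈ (N τ).source ∧ N τ (N (-τ) z) = z) := by
  let r : ℝ → Phase n → Phase n → Prop := fun τ =>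
    composeAll (S.steps.map (Step.exactFlow U a b V S.c τ))
  have hr : ∀ τ, S.integrator U a b V τ = r τ := integrator_eq_modifiedSplitting hU ha hb hV S
  have hflip : ∀ τ z w, r τ z w → r (-τ) w z := by
    intro τ z w h
    have := composeAll_map_flip (Step.exactFlow U a b V S.c τ) (Step.exactFlow U a b V S.c (-τ))
      (fun s z w => exactFlow_flip) S.steps h
    rwa [hpal] at this
  have hflip' : ∀ τ z w, r τ z w ↔ r (-τ) w z := fun τ z w =>
    ⟨hflip τ z w, fun h => by simpa using hflip (-τ) w z h⟩
  have huniq : ∀ τ z w w', r τ z w → r τ z w' → w = w' := fun τ z w w' h h' =>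
    composeAll_unique (by
      simp only [List.mem_map]
      rintro _ ⟨s, -, rfl⟩ z w w' h h'
      exact exactFlow_unique hU ha hb hV h h') h h'
  have hsymp : ∀ τ z w, r τ z w → IsLocallySymplecticAt (r τ) z w := fun τ z w h =>
    composeAll_isLocallySymplecticAt (by
      simp only [List.mem_map]
      rintro _ ⟨s, -, rfl⟩ z w h
      exact exactFlow_isLocallySymplecticAt hU ha hb hV h) h
  have hmem : ∀ τ z w, r τ z w → z ∈ phaseDomain U := by
    intro τ z w h
    obtain ⟨s, l, hl⟩ := List.exists_cons_of_ne_nil hne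
    simp only [r, hl, List.map_cons] at h
    obtain ⟨x, hx, -⟩ := h
    exact exactFlow_left_mem hx
  choose N hN hsm hJ using fun τ => exists_openPartialHomeomorph (hflip' τ) (huniq τ) (huniq (-τ))
    (hsymp τ) (hsymp (-τ))
  have hsource : ∀ τ z, z ∈ (N τ).source ↔ ∃ w, r τ z w := fun τ z =>
    ⟨fun h => ⟨_, (hN τ z _).mpr ⟨h, rfl⟩⟩, fun ⟨w, h⟩ => ((hN τ z w).mp h).1⟩
  have htarget : ∀ τ, (N (-τ)).source = (N τ).target := by
    intro τ
    ext w
    rw [hsource]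
    constructor
    · rintro ⟨z, h⟩
      obtain ⟨h1, rfl⟩ := (hN τ z w).mp ((hflip' τ z w).mpr h)
      exact (N τ).map_source h1
    · intro h
      exact ⟨_, (hflip' τ _ w).mp ((hN τ _ w).mpr ⟨(N τ).map_target h, (N τ).right_inv h⟩)⟩
  have hsub : ∀ τ, (N τ).source ⊆ phaseDomain U := by
    intro τ z hz
    obtain ⟨w, h⟩ := (hsource τ z).mp hz
    exact hmem τ z w h
  refine ⟨N, fun τ => by rw [hr]; exact hN τ, hsub, ?_, ?_, fun τ => ⟨hsm τ, hJ τ⟩, ?_⟩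
  · intro z hz
    have h := composeAll_map_eventually (Step.exactFlow U a b V S.c)
      (fun s z hz O hO => exactFlow_eventually hU ha hb hV S.c s hz hO) S.steps hz
      Filter.univ_mem
    have hι : Filter.Tendsto (fun τ : ℝ => (τ, z)) (𝓝 0) (𝓝 (0, z)) :=
      (by fun_prop : Continuous fun τ : ℝ => (τ, z)).tendsto 0
    filter_upwards [hι.eventually h] with τ hτ
    obtain ⟨w, -, hw⟩ := hτ
    exact (hsource τ z).mpr ⟨w, hw⟩
  · intro hcomplete
    have hfull : ∀ τ, (N τ).source = phaseDomain U := fun τ =>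
      (hsub τ).antisymm fun z hz => (hsource τ z).mpr (composeAll_total (by
        simp only [List.mem_map]
        rintro _ ⟨s, -, rfl⟩ z hz
        exact exactFlow_total hU ha hV hcomplete S.c τ s hz) hz)
    exact fun τ => ⟨hfull τ, by rw [← htarget, hfull]⟩
  · refine fun τ => ⟨htarget τ, fun z hz => ?_⟩
    have h := (hflip' τ _ z).mpr ((hN (-τ) z _).mpr ⟨hz, rfl⟩)
    exact (hN τ _ z).mp h

theorem Method.steps_reverse (m : Method) : m.scheme.steps.reverse = m.scheme.steps := by
  cases m <;> rfl

theorem Method.steps_ne_nil (m : Method) : m.scheme.steps ≠ [] := by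
  cases m <;> exact List.cons_ne_nil _ _

end

end ForceGradient

end

open ForceGradient in
theorem mainTheorem2 {n : ℕ} (U : Set (Fin n → ℝ)) (hU : IsOpen U)
    (a : Fin n → Fin n → (Fin n → ℝ) → ℝ) (b : Fin n → (Fin n → ℝ) → ℝ) (V : (Fin n → ℝ) → ℝ)
    (ha : ∀ i j, ContDiffOn ℝ 3 (a i j) U) (hb : ∀ i, ContDiffOn ℝ 3 (b i) U)
    (hV : ContDiffOn ℝ 3 V U) :
    -- the coefficients of `D = [B, [A, B]]`
    (∀ z ∈ phaseDomain U, ∀ i,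
      opD a b V z (Sum.inl i) = 0 ∧
      opD a b V z (Sum.inr i) = ∑ j, ∑ k,
        (2 * pd i (pd j V) (pos z) * pd k V (pos z) *
            pd (Sum.inr j) (pd (Sum.inr k) (kinetic a b)) z +
          pd j V (pos z) * pd k V (pos z) *
            pd (Sum.inl i) (pd (Sum.inr j) (pd (Sum.inr k) (kinetic a b))) z)) ∧
    -- `V_D` has the momentum components of `D` as its gradient
    ContDiffOn ℝ 2 (potD a V) U ∧
    (∀ z ∈ phaseDomain U, ∀ i, pd i (potD a V) (pos z) = opD a b V z (Sum.inr i)) ∧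
    -- the gradient of `V_D` in terms of symmetric `a`
    ((∀ q ∈ U, ∀ j k, a j k q = a k j q) → ∀ q ∈ U, ∀ i,
      pd i (potD a V) q = 2 * ∑ j, ∑ k,
        (2 * a j k q * pd i (pd j V) q * pd k V q + pd j V q * pd k V q * pd i (a j k) q)) ∧
    -- the exact flow of a modified potential is explicit
    (∀ c τ t : ℝ, ∀ z w : Phase n,
      FlowRel (phaseDomain U) (hamField (lift (modPot a V c τ))) t z w ↔
        z ∈ phaseDomain U ∧ pos w = pos z ∧
          ∀ i, mom w i = mom z i - t * (pd i V (pos z) - c * τ ^ 2 * pd i (potD a V) (pos z))) ∧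
    ∀ m : Method,
      -- palindromic, with exponents odd in `τ`
      m.scheme.steps.reverse = m.scheme.steps ∧
      (∀ τ : ℝ, m.scheme.exponents a b V (-τ) = (m.scheme.exponents a b V τ).map (fun X => -X)) ∧
      -- composition of exact flows of `K` and of modified potentials
      (∀ τ : ℝ, m.scheme.integrator U a b V τ = m.scheme.modifiedSplitting U a b V τ) ∧
      ∃ N : ℝ → OpenPartialHomeomorph (Phase n) (Phase n),
        -- the integrator is a (partially defined) map with an open domain
        (∀ τ z w, m.scheme.integrator U a b V τ z w ↔ z ∈ (N τ).source ∧ N τ z = w) ∧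
        (∀ τ, (N τ).source ⊆ phaseDomain U) ∧
        (∀ z ∈ phaseDomain U, ∀ᶠ τ in 𝓝 (0 : ℝ), z ∈ (N τ).source) ∧
        ((∀ t : ℝ, ∀ z ∈ phaseDomain U, ∃ w,
            FlowRel (phaseDomain U) (hamField (kinetic a b)) t z w) →
          ∀ τ, (N τ).source = phaseDomain U ∧ (N τ).target = phaseDomain U) ∧
        -- symplecticity
        (∀ τ, ContDiffOn ℝ 1 (N τ) (N τ).source ∧
          ∀ z ∈ (N τ).source,
            (jacobian (N τ) z).transpose * Matrix.J (Fin n) ℝ * jacobian (N τ) z =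
              Matrix.J (Fin n) ℝ ∧
            (jacobian (N τ) z).det = 1) ∧
        -- symmetry
        (∀ τ, (N (-τ)).source = (N τ).target ∧
          ∀ z ∈ (N (-τ)).source, N (-τ) z ∈ (N τ).source ∧ N τ (N (-τ) z) = z) := by
  refine ⟨fun z hz i => ⟨?_, opD_eq hU ha hb hV hz i⟩, contDiffOn_potD hU ha hV,
    fun z hz i => pd_potD_eq_opD hU ha hb hV hz i, fun hsymm q hq i => ?_,
    fun c τ t z w => flowRel_modPot_iff hU ha hV c τ t z w,
    fun m => ⟨m.steps_reverse, exponents_neg m.scheme,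
      integrator_eq_modifiedSplitting hU ha hb hV m.scheme,
      exists_integrator_openPartialHomeomorph hU ha hb hV m.scheme m.steps_ne_nil
        m.steps_reverse⟩⟩
  · rw [opD_apply hU ha hb hV hz]
    rfl
  · rw [pd_potD hU ha hV hq]
    simp only [Finset.mul_sum]
    refine Finset.sum_congr rfl fun j _ => Finset.sum_congr rfl fun k _ => ?_
    rw [← hsymm q hq j k]
    ring
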